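/- For a matrix $A$ with $N$ columns and $s\in\mathbb N$, let $\delta_s(A)$ be the $s$-th restricted isometry constant, i.e. the smallest $\delta\ge 0$ such that $(1-\delta)\|x\|_2^2\le\|Ax\|_2^2\le(1+\delta)\|x\|_2^2$ for all $x\in\mathbb C^N$ with at most $s$ nonzero entries. There exist universal constants $d_1,d_2>0$ such that the following holds. Let $N\in\mathbb N$, let $m$ be a real number with $2\le m\le N$, let $K\ge 1$, and let $U$ be a unitary $N\times N$ matrix with $\sqrt N\,|U_{kl}|\le K$ for all $k,l$. Let $\theta_1,\dots,\theta_N$ be i.i.d. random variables with values in $\{0,1\}$ and $\mathbb P(\theta_i=1)=m/N$, let $I=\{i:\theta_i=1\}$ and $U_I=\sqrt{N/m}\,R_IU$, where $R_I:\mathbb C^N\to\mathbb C^{|I|}$ restricts a vector to its entries in $I$. Then for every integer $s\ge 2$ and all $0<\delta,\eta<1$, $$\mathbb P(\delta_s(U_I)\ge\delta)\le\eta$$ provided that $$m\ \ge\ sK^2\delta^{-2}\max\{d_1\log^2 s\,\log m\,\log N,\ d_2\log(\eta^{-1})\}.$$ -/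

import Mathlib

/-- The support size `‖x‖₀` of `x` is at most `s`. -/
def IsSparse {N : ℕ} (s : ℕ) (x : EuclideanSpace ℂ (Fin N)) : Prop :=
  (Finset.univ.filter fun i => x i ≠ 0).card ≤ s

/-- The constants `δ ≥ 0` such that `(1 - δ) ‖x‖₂² ≤ ‖A x‖₂² ≤ (1 + δ) ‖x‖₂²` for all
`s`-sparse `x`. -/
def ripConstants {ι : Type*} [Fintype ι] {N : ℕ} (s : ℕ) (A : Matrix ι (Fin N) ℂ) : Set ℝ :=
  {δ : ℝ | 0 ≤ δ ∧ ∀ x : EuclideanSpace ℂ (Fin N), IsSparse s x →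
    (1 - δ) * ‖x‖ ^ 2 ≤ ‖WithLp.toLp 2 (A.mulVec x.ofLp)‖ ^ 2 ∧
      ‖WithLp.toLp 2 (A.mulVec x.ofLp)‖ ^ 2 ≤ (1 + δ) * ‖x‖ ^ 2}

/-- The `s`-th restricted isometry constant of `A`: the smallest element of `ripConstants s A`
(it exists, see `isLeast_restrictedIsometryConstant`). -/
noncomputable def restrictedIsometryConstant {ι : Type*} [Fintype ι] {N : ℕ} (s : ℕ)
    (A : Matrix ι (Fin N) ℂ) : ℝ :=
  sInf (ripConstants s A)

theorem isLeast_restrictedIsometryConstant {ι : Type*} [Fintype ι] {N : ℕ} (s : ℕ)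
    (A : Matrix ι (Fin N) ℂ) :
    IsLeast (ripConstants s A) (restrictedIsometryConstant s A) := by
  classical
  have hbdd : BddBelow (ripConstants s A) := ⟨0, fun δ hδ => hδ.1⟩
  have hne : (ripConstants s A).Nonempty := by
    set L := LinearMap.toContinuousLinearMap (Matrix.toEuclideanLin A) with hL
    have hLx : ∀ x : EuclideanSpace ℂ (Fin N), L x = WithLp.toLp 2 (A.mulVec x.ofLp) :=
      fun x => rfl
    refine ⟨1 + ‖L‖ ^ 2, by positivity, fun x _ => ?_⟩
    rw [← hLx]
    have h1 : ‖L x‖ ^ 2 ≤ ‖L‖ ^ 2 * ‖x‖ ^ 2 := by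
      rw [← mul_pow]
      exact pow_le_pow_left₀ (norm_nonneg _) (L.le_opNorm x) 2
    constructor <;> nlinarith [sq_nonneg ‖x‖, sq_nonneg ‖L x‖,
      mul_nonneg (sq_nonneg ‖L‖) (sq_nonneg ‖x‖)]
  have hclosed : IsClosed (ripConstants s A) := by
    have : ripConstants s A = Set.Ici 0 ∩ ⋂ x : EuclideanSpace ℂ (Fin N), ⋂ _ : IsSparse s x,
        ({δ : ℝ | (1 - δ) * ‖x‖ ^ 2 ≤ ‖WithLp.toLp 2 (A.mulVec x.ofLp)‖ ^ 2} ∩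
          {δ : ℝ | ‖WithLp.toLp 2 (A.mulVec x.ofLp)‖ ^ 2 ≤ (1 + δ) * ‖x‖ ^ 2}) := by
      ext δ
      simp [ripConstants]
    rw [this]
    refine isClosed_Ici.inter (isClosed_iInter fun x => isClosed_iInter fun _ => ?_)
    exact (isClosed_le (by fun_prop) (by fun_prop)).inter
      (isClosed_le (by fun_prop) (by fun_prop))
  exact ⟨hclosed.csInf_mem hne hbdd, fun δ hδ => csInf_le hbdd hδ⟩

/-- The matrix `√(N / m) R_I U`, where `R_I` restricts a vector to its entries in `I`. -/
noncomputable def subsampledMatrix {N : ℕ} (U : Matrix (Fin N) (Fin N) ℂ) (m : ℝ)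
    (I : Finset (Fin N)) : Matrix I (Fin N) ℂ :=
  ((Real.sqrt (N / m) : ℝ) : ℂ) • U.submatrix (fun i : I => (i : Fin N)) id

/-- The set of selected indices `I = {i : θ_i = 1}` for given values of the selectors. -/
def selectedIndices {N : ℕ} (t : Fin N → Fin 2) : Finset (Fin N) :=
  Finset.univ.filter fun i => t i = 1

/-! ### Product Bernoulli probabilities on the discrete cube -/

/-! Put V = √N U, so that the entries of V are at most K and ∑ |(Vx)_i|² = N ‖x‖². The isometry
constant of `subsampledMatrix` is governed by the supremum, over the s-sparse unit ball, of the
deviation |m⁻¹ ∑_{i ∈ I} |(Vx)_i|² − ‖x‖²|. Only the joint law of the selectors matters, so the tail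
of this supremum is estimated on the finite cube with product Bernoulli weights.

Symmetrization is done on tails. Compare the selectors with an independent copy: exchanging the two
copies at random coordinates preserves the law and turns the difference of deviations into a
Rademacher process x ↦ ∑_{i ∈ J} ±|(Vx)_i|², where J is the set where the copies differ. If the
energy of Vx on J is at most ρ² on the whole ball, increments of this process are subgaussian with
parameter 2ρ max_{i ∈ J} |(V(x−y))_i|.

The ball is covered in this max-seminorm by Maurey's method (`exists_net_maurey`). It lies in 2√s
times the convex hull of 4N+1 vertices, and averages of n ≈ sK² log|J| / r² vertices are r-accurate,
so the log-covering number is of order sK² log m log N / r². Hence each dyadic scale from √s K down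
to about K/√s contributes the same amount, and the roughly log s scales give log² s log m log N
after squaring. Below K/√s one coordinate grid (`exists_net_grid`) suffices. Altogether the process
is at most Aρ off an event of probability q (`cubeProb_sup_signSum_le`).

But ρ² is itself of size m(1 + deviation). Restricting to deviations at most 2τ bounds ρ and yields
P(sup > τ) ≤ 4 P(sup > 2τ) + 6q (`cubeProb_sup_sampleDeviation_doubling`) as soon as A²(1+τ) is
small against mτ². Since the deviation never exceeds N, iteration stops after about log₂(N/δ)
doublings. The accumulated factor is polynomial in N and is absorbed by q = η/N⁸. -/

/-- The weight of `t` under the product of Bernoulli distributions with parameter `p`. -/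
noncomputable def cubeWeight {ι : Type*} [Fintype ι] (p : ℝ) (t : ι → Fin 2) : ℝ :=
  ∏ i, if t i = 1 then p else 1 - p

/-- The product Bernoulli probability of a set of points of the cube. -/
noncomputable def cubeProb {ι : Type*} [Fintype ι] [DecidableEq ι] (p : ℝ)
    (A : Set (ι → Fin 2)) : ℝ :=
  ∑ t, A.indicator (cubeWeight p) t

/-- The sign `±1` attached to a value of a selector. -/
noncomputable def fairSign (a : Fin 2) : ℝ := if a = 1 then 1 else -1

section Cube

variable {ι : Type*} [Fintype ι]

theorem cubeWeight_nonneg {p : ℝ} (h0 : 0 ≤ p) (h1 : p ≤ 1) (t : ι → Fin 2) :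
    0 ≤ cubeWeight p t := by
  refine Finset.prod_nonneg fun i _ => ?_
  split_ifs <;> linarith

variable [DecidableEq ι]

theorem sum_cubeWeight_mul_prod (p : ℝ) (g : ι → Fin 2 → ℝ) :
    ∑ t : ι → Fin 2, cubeWeight p t * ∏ i, g i (t i) =
      ∏ i, (p * g i 1 + (1 - p) * g i 0) := by
  have h := Finset.prod_univ_sum (fun _ : ι => (Finset.univ : Finset (Fin 2)))
    (fun i a => (if a = 1 then p else 1 - p) * g i a)
  rw [Fintype.piFinset_univ] at h
  simp only [Fin.sum_univ_two] at h
  simp only [cubeWeight, ← Finset.prod_mul_distrib]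
  rw [← h]
  refine Finset.prod_congr rfl fun i _ => ?_
  simp [add_comm]

theorem sum_cubeWeight (p : ℝ) : ∑ t : ι → Fin 2, cubeWeight p t = 1 := by
  have h := sum_cubeWeight_mul_prod p (fun (_ : ι) _ => (1 : ℝ))
  simpa using h

theorem cubeProb_mono {p : ℝ} (h0 : 0 ≤ p) (h1 : p ≤ 1) {A B : Set (ι → Fin 2)} (h : A ⊆ B) :
    cubeProb p A ≤ cubeProb p B :=
  Finset.sum_le_sum fun t _ =>
    Set.indicator_le_indicator_of_subset h (fun t => cubeWeight_nonneg h0 h1 t) t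

theorem cubeProb_nonneg {p : ℝ} (h0 : 0 ≤ p) (h1 : p ≤ 1) (A : Set (ι → Fin 2)) :
    0 ≤ cubeProb p A :=
  Finset.sum_nonneg fun t _ => Set.indicator_nonneg (fun t _ => cubeWeight_nonneg h0 h1 t) t

theorem cubeProb_empty (p : ℝ) : cubeProb p (∅ : Set (ι → Fin 2)) = 0 := by
  simp [cubeProb]

theorem cubeProb_univ (p : ℝ) : cubeProb p (Set.univ : Set (ι → Fin 2)) = 1 := by
  simp [cubeProb, sum_cubeWeight]

theorem cubeProb_compl (p : ℝ) (A : Set (ι → Fin 2)) : cubeProb p Aᶜ = 1 - cubeProb p A := by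
  rw [eq_sub_iff_add_eq, ← sum_cubeWeight (ι := ι) p, cubeProb, cubeProb, ← Finset.sum_add_distrib]
  refine Finset.sum_congr rfl fun t _ => ?_
  exact congrFun (Set.indicator_compl_add_self A (cubeWeight p)) t

theorem cubeProb_union_le {p : ℝ} (h0 : 0 ≤ p) (h1 : p ≤ 1) (A B : Set (ι → Fin 2)) :
    cubeProb p (A ∪ B) ≤ cubeProb p A + cubeProb p B := by
  rw [cubeProb, cubeProb, cubeProb, ← Finset.sum_add_distrib]
  refine Finset.sum_le_sum fun t _ => ?_
  have := cubeWeight_nonneg h0 h1 t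
  by_cases hA : t ∈ A <;> by_cases hB : t ∈ B <;> simp [hA, hB, this]

theorem cubeProb_biUnion_le {p : ℝ} (h0 : 0 ≤ p) (h1 : p ≤ 1) {α : Type*} (S : Finset α)
    (A : α → Set (ι → Fin 2)) {c : ℝ} (hc : ∀ a ∈ S, cubeProb p (A a) ≤ c) :
    cubeProb p {t | ∃ a ∈ S, t ∈ A a} ≤ S.card * c := by
  classical
  induction S using Finset.induction_on with
  | empty => simp [cubeProb]
  | insert a S ha ih =>
    have hset : {t | ∃ b ∈ insert a S, t ∈ A b} = A a ∪ {t | ∃ b ∈ S, t ∈ A b} := by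
      ext t; simp
    rw [hset, Finset.card_insert_of_notMem ha]
    have h2 := ih fun b hb => hc b (Finset.mem_insert_of_mem hb)
    have h3 := hc a (Finset.mem_insert_self a S)
    refine (cubeProb_union_le h0 h1 _ _).trans ?_
    push_cast
    linarith

theorem cubeProb_le_sum {p : ℝ} (h0 : 0 ≤ p) (h1 : p ≤ 1) {A : Set (ι → Fin 2)}
    {F : (ι → Fin 2) → ℝ} (hF : ∀ t, 0 ≤ F t) (hA : ∀ t ∈ A, 1 ≤ F t) :
    cubeProb p A ≤ ∑ t, cubeWeight p t * F t := by
  refine Finset.sum_le_sum fun t _ => ?_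
  have hw := cubeWeight_nonneg h0 h1 t
  by_cases h : t ∈ A
  · simpa [h] using le_mul_of_one_le_right hw (hA t h)
  · simpa [h] using mul_nonneg hw (hF t)

/-- Chernoff's bound for a sum of independent functions of the coordinates. -/
theorem cubeProb_sum_gt_le {p : ℝ} (h0 : 0 ≤ p) (h1 : p ≤ 1) (g : ι → Fin 2 → ℝ) (c : ι → ℝ)
    (hg : ∀ i, p * Real.exp (g i 1) + (1 - p) * Real.exp (g i 0) ≤ Real.exp (c i)) (u : ℝ) :
    cubeProb p {t | u < ∑ i, g i (t i)} ≤ Real.exp (∑ i, c i - u) := by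
  refine (cubeProb_le_sum h0 h1 (F := fun t => Real.exp (-u) * ∏ i, Real.exp (g i (t i)))
    (fun t => by positivity) ?_).trans ?_
  · intro t ht
    rw [← Real.exp_sum, ← Real.exp_add]
    exact Real.one_le_exp (by have : u < ∑ i, g i (t i) := ht; linarith)
  · have hr : ∀ t : ι → Fin 2, cubeWeight p t * (Real.exp (-u) * ∏ i, Real.exp (g i (t i))) =
        Real.exp (-u) * (cubeWeight p t * ∏ i, Real.exp (g i (t i))) := fun t => by ring
    simp only [hr, ← Finset.mul_sum]
    rw [sum_cubeWeight_mul_prod p (fun i a => Real.exp (g i a)),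
      show ∑ i, c i - u = -u + ∑ i, c i by ring, Real.exp_add, Real.exp_sum]
    refine mul_le_mul_of_nonneg_left ?_ (Real.exp_pos _).le
    refine Finset.prod_le_prod (fun i _ => ?_) fun i _ => hg i
    have : 0 ≤ 1 - p := by linarith
    positivity

/-- Two-sided version of Chernoff's bound. -/
theorem cubeProb_abs_sum_gt_le {p : ℝ} (h0 : 0 ≤ p) (h1 : p ≤ 1) (g : ι → Fin 2 → ℝ) (c : ι → ℝ)
    (hg : ∀ i, p * Real.exp (g i 1) + (1 - p) * Real.exp (g i 0) ≤ Real.exp (c i))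
    (hg' : ∀ i, p * Real.exp (-g i 1) + (1 - p) * Real.exp (-g i 0) ≤ Real.exp (c i)) (u : ℝ) :
    cubeProb p {t | u < |∑ i, g i (t i)|} ≤ 2 * Real.exp (∑ i, c i - u) := by
  have hset : {t : ι → Fin 2 | u < |∑ i, g i (t i)|} =
      {t | u < ∑ i, g i (t i)} ∪ {t | u < ∑ i, -g i (t i)} := by
    ext t; simp [lt_abs]
  rw [hset]
  refine (cubeProb_union_le h0 h1 _ _).trans ?_
  have h2 := cubeProb_sum_gt_le h0 h1 g c hg u
  have h3 := cubeProb_sum_gt_le h0 h1 (fun i a => -g i a) c hg' u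
  linarith

/-- Hoeffding's inequality for Rademacher sums. -/
theorem cubeProb_rademacher_le (a : ι → ℝ) {σ u : ℝ} (hσ : 0 < σ) (hu : 0 ≤ u)
    (ha : ∑ i, a i ^ 2 ≤ σ ^ 2) :
    cubeProb (1 / 2) {t | u < |∑ i, fairSign (t i) * a i|} ≤
      2 * Real.exp (-(u ^ 2 / (2 * σ ^ 2))) := by
  rcases hu.eq_or_lt with rfl | hu
  · refine (cubeProb_mono (by norm_num) (by norm_num) (Set.subset_univ _)).trans ?_
    rw [cubeProb_univ]; simp
  -- Minimizer of the Chernoff exponent l²σ²/2 − lu.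
  set l : ℝ := u / σ ^ 2 with hl
  have hl0 : 0 < l := by positivity
  have hcosh : ∀ y : ℝ, 1 / 2 * Real.exp y + (1 - 1 / 2) * Real.exp (-y) ≤
      Real.exp (y ^ 2 / 2) := fun y => by
    refine le_trans (le_of_eq ?_) (Real.cosh_le_exp_half_sq y)
    rw [Real.cosh_eq]; ring
  have key := cubeProb_abs_sum_gt_le (p := 1 / 2) (by norm_num) (by norm_num)
    (fun i b => l * (fairSign b * a i)) (fun i => (l * a i) ^ 2 / 2)
    (fun i => by
      refine le_trans (le_of_eq ?_) (hcosh (l * a i))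
      simp [fairSign])
    (fun i => by
      refine le_trans (le_of_eq ?_) (hcosh (l * a i))
      simp [fairSign]; ring) (l * u)
  refine le_trans (cubeProb_mono (by norm_num) (by norm_num) ?_) (key.trans ?_)
  · intro t ht
    simp only [Set.mem_ofPred_eq] at ht ⊢
    rw [← Finset.mul_sum, abs_mul, abs_of_pos hl0]
    exact mul_lt_mul_of_pos_left ht hl0
  · refine mul_le_mul_of_nonneg_left (Real.exp_le_exp.2 ?_) (by norm_num)
    have h1 : ∑ i, (l * a i) ^ 2 / 2 = l ^ 2 / 2 * ∑ i, a i ^ 2 := by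
      rw [Finset.mul_sum]; exact Finset.sum_congr rfl fun i _ => by ring
    rw [h1]
    have h2 : l ^ 2 / 2 * ∑ i, a i ^ 2 ≤ l ^ 2 / 2 * σ ^ 2 :=
      mul_le_mul_of_nonneg_left ha (by positivity)
    have h3 : l ^ 2 / 2 * σ ^ 2 - l * u = -(u ^ 2 / (2 * σ ^ 2)) := by
      rw [hl]; field_simp; ring
    linarith

theorem exp_le_one_add_add_sq {y : ℝ} (hy : |y| ≤ 1) : Real.exp y ≤ 1 + y + y ^ 2 := by
  have h := (abs_le.1 (Real.abs_exp_sub_one_sub_id_le hy)).2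
  linarith

/-- Bernstein-type bound for centred sums of scaled Bernoulli selectors. -/
theorem cubeProb_bernoulli_le {p : ℝ} (h0 : 0 < p) (h1 : p ≤ 1) (a : ι → ℝ) {l u v : ℝ}
    (hl : 0 < l) (ha : ∀ i, 0 ≤ a i) (hla : ∀ i, l * a i ≤ p) (hv : ∑ i, a i ^ 2 ≤ p * v) :
    cubeProb p {t | u < |∑ i, ((if t i = 1 then p⁻¹ else 0) - 1) * a i|} ≤
      2 * Real.exp (l ^ 2 * v - l * u) := by
  -- The bound |b| ≤ p keeps both exponents in [−1, 1], where exp y ≤ 1 + y + y². The linear terms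
  -- cancel and the variance is b²/p − b².
  have hgen : ∀ b : ℝ, |b| ≤ p → p * Real.exp (b * (p⁻¹ - 1)) + (1 - p) * Real.exp (-b) ≤
      Real.exp (b ^ 2 / p) := by
    intro b hb
    have hp1 : 0 ≤ 1 - p := by linarith
    have hinv : 1 ≤ p⁻¹ := (one_le_inv₀ h0).2 h1
    have e1 := exp_le_one_add_add_sq (y := b * (p⁻¹ - 1)) (by
      rw [abs_mul, abs_of_nonneg (by linarith : 0 ≤ p⁻¹ - 1)]
      calc |b| * (p⁻¹ - 1) ≤ p * (p⁻¹ - 1) := mul_le_mul_of_nonneg_right hb (by linarith)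
        _ = 1 - p := by field_simp
        _ ≤ 1 := by linarith)
    have e2 := exp_le_one_add_add_sq (y := -b) (by rw [abs_neg]; linarith)
    calc p * Real.exp (b * (p⁻¹ - 1)) + (1 - p) * Real.exp (-b)
        ≤ p * (1 + b * (p⁻¹ - 1) + (b * (p⁻¹ - 1)) ^ 2) + (1 - p) * (1 + -b + (-b) ^ 2) :=
          add_le_add (mul_le_mul_of_nonneg_left e1 h0.le) (mul_le_mul_of_nonneg_left e2 hp1)
      _ = 1 + b ^ 2 / p - b ^ 2 := by field_simp; ring
      _ ≤ b ^ 2 / p + 1 := by nlinarith [sq_nonneg b]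
      _ ≤ Real.exp (b ^ 2 / p) := Real.add_one_le_exp _
  have key := cubeProb_abs_sum_gt_le (p := p) h0.le h1
    (fun i b => l * (((if b = 1 then p⁻¹ else 0) - 1) * a i)) (fun i => (l * a i) ^ 2 / p)
    (fun i => by
      refine le_trans (le_of_eq ?_) (hgen (l * a i) ?_)
      · rw [if_pos rfl, if_neg (by decide)]; ring_nf
      · rw [abs_of_nonneg (mul_nonneg hl.le (ha i))]; exact hla i)
    (fun i => by
      refine le_trans (le_of_eq ?_) ((hgen (-(l * a i)) ?_).trans (le_of_eq ?_))
      · rw [if_pos rfl, if_neg (by decide)]; ring_nf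
      · rw [abs_neg, abs_of_nonneg (mul_nonneg hl.le (ha i))]; exact hla i
      · rw [neg_sq]) (l * u)
  refine le_trans (cubeProb_mono h0.le h1 ?_) (key.trans ?_)
  · intro t ht
    simp only [Set.mem_ofPred_eq] at ht ⊢
    rw [← Finset.mul_sum, abs_mul, abs_of_pos hl]
    exact mul_lt_mul_of_pos_left ht hl
  · refine mul_le_mul_of_nonneg_left (Real.exp_le_exp.2 ?_) (by norm_num)
    have h2 : ∑ i, (l * a i) ^ 2 / p = l ^ 2 / p * ∑ i, a i ^ 2 := by
      rw [Finset.mul_sum]; exact Finset.sum_congr rfl fun i _ => by ring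
    rw [h2]
    have h3 : l ^ 2 / p * ∑ i, a i ^ 2 ≤ l ^ 2 / p * (p * v) :=
      mul_le_mul_of_nonneg_left hv (by positivity)
    have h4 : l ^ 2 / p * (p * v) = l ^ 2 * v := by field_simp
    linarith

/-- It is unlikely that more than three times the expected number of indices is selected. -/
theorem cubeProb_card_gt_le {p : ℝ} (h0 : 0 ≤ p) (h1 : p ≤ 1) {m : ℝ}
    (hm : Fintype.card ι * p = m) :
    cubeProb p {t : ι → Fin 2 | 3 * m < ((Finset.univ.filter fun i => t i = 1).card : ℝ)} ≤
      Real.exp (-m) := by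
  have he : Real.exp 1 ≤ 3 := by have := Real.exp_one_lt_d9; linarith
  -- Exponential parameter 1: since e ≤ 3, each factor is at most 1 + 2p ≤ exp(2p), and the exponent
  -- becomes 2m − 3m = −m.
  have key := cubeProb_sum_gt_le (ι := ι) h0 h1 (fun _ b => if b = 1 then 1 else 0)
    (fun _ => 2 * p) (fun i => by
      have := Real.add_one_le_exp (2 * p)
      simp
      nlinarith) (3 * m)
  refine le_trans (cubeProb_mono h0 h1 ?_) (key.trans ?_)
  · intro t ht
    simpa [Finset.sum_ite] using ht
  · refine Real.exp_le_exp.2 (le_of_eq ?_)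
    simp only [Finset.sum_const, Finset.card_univ, nsmul_eq_mul]
    rw [← hm]; ring

end Cube

/-! ### Nets of the sparse unit ball -/

/-- The `s`-sparse vectors of Euclidean norm at most one. -/
def sparseBall (N s : ℕ) : Set (Fin N → ℂ) :=
  {x | (Finset.univ.filter fun i => x i ≠ 0).card ≤ s ∧ ∑ i, ‖x i‖ ^ 2 ≤ 1}

/-- The linear term y averages to zero for centred variables, so this gives an exponential moment
bound without any restriction on the size of y. -/
theorem exp_le_add_exp_sq (y : ℝ) : Real.exp y ≤ y + Real.exp (y ^ 2) := by
  have h1 := Real.add_one_le_exp (y ^ 2)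
  rcases le_total |y| 1 with h | h
  · have := exp_le_one_add_add_sq h
    linarith
  · rcases le_total 0 y with h0 | h0
    · rw [abs_of_nonneg h0] at h
      have : Real.exp y ≤ Real.exp (y ^ 2) := Real.exp_le_exp.2 (by nlinarith)
      linarith
    · rw [abs_of_nonpos h0] at h
      have : Real.exp y ≤ 1 := Real.exp_le_one_iff.2 h0
      nlinarith

/-- Averaging principle, used to replace a random choice of vertices by a deterministic one. -/
theorem exists_le_of_weighted_sum_le {A : Type*} [Fintype A] {w Φ : A → ℝ} {M : ℝ}
    (hw : ∀ a, 0 ≤ w a) (hw1 : ∑ a, w a = 1) (h : ∑ a, w a * Φ a ≤ M) : ∃ a, Φ a ≤ M := by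
  by_contra! hcon
  have h1 : ∑ a, w a * (Φ a - M) ≤ 0 := by
    simp only [mul_sub, Finset.sum_sub_distrib, ← Finset.sum_mul, hw1]
    linarith
  have hnn : ∀ a ∈ Finset.univ, 0 ≤ w a * (Φ a - M) := fun a _ =>
    mul_nonneg (hw a) (sub_nonneg.2 (hcon a).le)
  have h2 := (Finset.sum_eq_zero_iff_of_nonneg hnn).1 (le_antisymm h1 (Finset.sum_nonneg hnn))
  have h3 : ∀ a, w a = 0 := fun a => by
    rcases mul_eq_zero.1 (h2 a (Finset.mem_univ a)) with h | h
    · exact h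
    · exact absurd h (sub_pos.2 (hcon a)).ne'
  simp [h3] at hw1

/-- One-step exponential moment bound for a centred bounded random variable. -/
theorem sum_weight_exp_le {A : Type*} [Fintype A] {w y : A → ℝ} {c : ℝ}
    (hw : ∀ a, 0 ≤ w a) (hw1 : ∑ a, w a = 1) (hy : ∑ a, w a * y a = 0) (hc : ∀ a, |y a| ≤ c) :
    ∑ a, w a * Real.exp (y a) ≤ Real.exp (c ^ 2) := by
  calc ∑ a, w a * Real.exp (y a) ≤ ∑ a, w a * (y a + Real.exp (c ^ 2)) := by
        refine Finset.sum_le_sum fun a _ => mul_le_mul_of_nonneg_left ?_ (hw a)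
        refine (exp_le_add_exp_sq _).trans ?_
        have := sq_le_sq' (abs_le.1 (hc a)).1 (abs_le.1 (hc a)).2
        linarith [Real.exp_le_exp.2 this]
    _ = Real.exp (c ^ 2) := by
        simp only [mul_add, Finset.sum_add_distrib, hy, ← Finset.sum_mul, hw1]
        ring

/-- Greedy choice of an empirical average that keeps an exponential potential small. -/
theorem exists_seq_sum_cosh_le {A Λ : Type*} [Fintype A] [Fintype Λ] {z : A → Λ → ℝ} {w : A → ℝ}
    {B l : ℝ} (hz : ∀ a i, |z a i| ≤ B) (hw : ∀ a, 0 ≤ w a) (hw1 : ∑ a, w a = 1) (hl : 0 ≤ l)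
    (n : ℕ) :
    ∃ a : Fin n → A, ∑ i, Real.cosh (l * ∑ k, (z (a k) i - ∑ b, w b * z b i)) ≤
      Fintype.card Λ * Real.exp ((l * (2 * B)) ^ 2 * n) := by
  induction n with
  | zero => exact ⟨Fin.elim0, by simp⟩
  | succ n ih =>
    obtain ⟨a, ha⟩ := ih
    set c : ℝ := l * (2 * B) with hc
    set y : A → Λ → ℝ := fun b i => l * (z b i - ∑ b, w b * z b i) with hy
    set S : Λ → ℝ := fun i => l * ∑ k, (z (a k) i - ∑ b, w b * z b i) with hS
    have hmean : ∀ i, |∑ b, w b * z b i| ≤ B := fun i => by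
      refine (Finset.abs_sum_le_sum_abs _ _).trans ?_
      calc ∑ b, |w b * z b i| ≤ ∑ b, w b * B := by
            refine Finset.sum_le_sum fun b _ => ?_
            rw [abs_mul, abs_of_nonneg (hw b)]
            exact mul_le_mul_of_nonneg_left (hz b i) (hw b)
        _ = B := by rw [← Finset.sum_mul, hw1, one_mul]
    have hyc : ∀ b i, |y b i| ≤ c := fun b i => by
      rw [hy, hc]
      simp only [abs_mul, abs_of_nonneg hl]
      refine mul_le_mul_of_nonneg_left ?_ hl
      have := abs_sub (z b i) (∑ b, w b * z b i)
      linarith [hz b i, hmean i]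
    have hy0 : ∀ i, ∑ b, w b * y b i = 0 := fun i => by
      have : ∀ b, w b * y b i = l * (w b * z b i) - l * (∑ b, w b * z b i) * w b :=
        fun b => by simp only [hy]; ring
      simp only [this, Finset.sum_sub_distrib, ← Finset.mul_sum, hw1]
      ring
    -- Averaged over the next vertex, the potential grows by a factor of at most exp(c²), so some
    -- vertex does no worse. Using cosh controls both signs of every coordinate at once.
    have hstep : ∑ b, w b * ∑ i, Real.cosh (S i + y b i) ≤
        Fintype.card Λ * Real.exp (c ^ 2 * (n + 1 : ℕ)) := by
      have hi : ∀ i, ∑ b, w b * Real.cosh (S i + y b i) ≤ Real.cosh (S i) * Real.exp (c ^ 2) := by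
        intro i
        have e1 := sum_weight_exp_le hw hw1 (hy0 i) (fun b => hyc b i)
        have e2 := sum_weight_exp_le (y := fun b => -y b i) hw hw1
          (by simp only [mul_neg, Finset.sum_neg_distrib, hy0 i, neg_zero])
          (fun b => by rw [abs_neg]; exact hyc b i)
        have e3 : ∑ b, w b * Real.cosh (S i + y b i) =
            Real.exp (S i) / 2 * ∑ b, w b * Real.exp (y b i) +
              Real.exp (-S i) / 2 * ∑ b, w b * Real.exp (-y b i) := by
          rw [Finset.mul_sum, Finset.mul_sum, ← Finset.sum_add_distrib]
          refine Finset.sum_congr rfl fun b _ => ?_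
          rw [Real.cosh_eq, neg_add, Real.exp_add, Real.exp_add]
          ring
        rw [e3, Real.cosh_eq]
        have := mul_le_mul_of_nonneg_left e1 (by positivity : 0 ≤ Real.exp (S i) / 2)
        have := mul_le_mul_of_nonneg_left e2 (by positivity : 0 ≤ Real.exp (-S i) / 2)
        linarith
      calc ∑ b, w b * ∑ i, Real.cosh (S i + y b i)
          = ∑ i, ∑ b, w b * Real.cosh (S i + y b i) := by
            simp only [Finset.mul_sum]; exact Finset.sum_comm
        _ ≤ ∑ i, Real.cosh (S i) * Real.exp (c ^ 2) := Finset.sum_le_sum fun i _ => hi i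
        _ = (∑ i, Real.cosh (S i)) * Real.exp (c ^ 2) := by rw [Finset.sum_mul]
        _ ≤ (Fintype.card Λ * Real.exp (c ^ 2 * n)) * Real.exp (c ^ 2) :=
            mul_le_mul_of_nonneg_right ha (Real.exp_pos _).le
        _ = Fintype.card Λ * Real.exp (c ^ 2 * (n + 1 : ℕ)) := by
            rw [mul_assoc, ← Real.exp_add]; push_cast; ring_nf
    obtain ⟨b, hb⟩ := exists_le_of_weighted_sum_le hw hw1 hstep
    refine ⟨Fin.cons b a, le_trans (le_of_eq ?_) hb⟩
    refine Finset.sum_congr rfl fun i _ => ?_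
    rw [Fin.sum_univ_succ]
    simp only [Fin.cons_zero, Fin.cons_succ, hS, hy]
    ring_nf

/-- Maurey's empirical method: a convex combination is close to an average of `n` vertices. -/
theorem exists_seq_abs_sum_sub_le {A Λ : Type*} [Fintype A] [Fintype Λ] {z : A → Λ → ℝ}
    {w : A → ℝ} {B r L : ℝ} (hB : 0 < B) (hr : 0 < r) (hz : ∀ a i, |z a i| ≤ B)
    (hw : ∀ a, 0 ≤ w a) (hw1 : ∑ a, w a = 1) {n : ℕ} (hL : 2 * Fintype.card Λ ≤ Real.exp L)
    (hn : 16 * B ^ 2 * L ≤ n * r ^ 2) :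
    ∃ a : Fin n → A, ∀ i, |∑ k, z (a k) i - n * ∑ b, w b * z b i| ≤ n * r := by
  -- With this l, the potential's exponent (2lB)²n equals nr²/(16B²), L is at most that amount, and
  -- l·n·r is exactly twice it.
  set l : ℝ := r / (8 * B ^ 2) with hl
  have hl0 : 0 < l := by positivity
  obtain ⟨a, ha⟩ := exists_seq_sum_cosh_le hz hw hw1 hl0.le n
  refine ⟨a, fun i => ?_⟩
  set S : ℝ := ∑ k, z (a k) i - n * ∑ b, w b * z b i with hS
  have hSS : ∑ k, (z (a k) i - ∑ b, w b * z b i) = S := by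
    rw [Finset.sum_sub_distrib, hS]; simp
  have h1 : Real.cosh (l * S) ≤ Fintype.card Λ * Real.exp ((l * (2 * B)) ^ 2 * n) := by
    refine le_trans ?_ ha
    rw [← hSS]
    exact Finset.single_le_sum
      (f := fun i => Real.cosh (l * ∑ k, (z (a k) i - ∑ b, w b * z b i)))
      (fun i _ => (Real.cosh_pos _).le) (Finset.mem_univ i)
  have h2 : Real.exp (l * |S|) ≤ 2 * Real.cosh (l * S) := by
    rw [Real.cosh_eq]
    rcases abs_cases S with ⟨h, _⟩ | ⟨h, _⟩ <;> rw [h]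
    · linarith [Real.exp_pos (-(l * S))]
    · rw [mul_neg]; linarith [Real.exp_pos (l * S)]
  have h3 : Real.exp (l * |S|) ≤ Real.exp (L + (l * (2 * B)) ^ 2 * n) := by
    rw [Real.exp_add]
    have := mul_le_mul_of_nonneg_right hL (Real.exp_pos ((l * (2 * B)) ^ 2 * n)).le
    linarith
  have h4 := Real.exp_le_exp.1 h3
  have h5 : L + (l * (2 * B)) ^ 2 * n ≤ l * (n * r) := by
    have e1 : L ≤ n * r ^ 2 / (16 * B ^ 2) := by
      rw [le_div_iff₀ (by positivity)]; linarith
    have e2 : (l * (2 * B)) ^ 2 * n = n * r ^ 2 / (16 * B ^ 2) := by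
      rw [hl]; field_simp; ring
    have e3 : l * (n * r) = n * r ^ 2 / (16 * B ^ 2) + n * r ^ 2 / (16 * B ^ 2) := by
      rw [hl]; field_simp; ring
    linarith
  exact le_of_mul_le_mul_left (h4.trans h5) hl0

/-- Nets come from encodings: if sharing a code forces two points to be near, one representative per
occurring code is a net. Representatives stay inside `D`, where energy bounds are available. -/
theorem exists_finset_net {E C : Type*} [Fintype C] (D : Set E) (R : E → C → Prop)
    (near : E → E → Prop) (hR : ∀ x ∈ D, ∃ c, R x c)
    (h : ∀ x ∈ D, ∀ y ∈ D, ∀ c, R x c → R y c → near x y) :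
    ∃ T : Finset E, (∀ y ∈ T, y ∈ D) ∧ T.card ≤ Fintype.card C ∧ ∀ x ∈ D, ∃ y ∈ T, near x y := by
  classical
  let S : Finset C := Finset.univ.filter fun c => ∃ x ∈ D, R x c
  have hS : ∀ c : S, ∃ x ∈ D, R x c := fun c => (Finset.mem_filter.1 c.2).2
  choose f hfD hfR using hS
  refine ⟨Finset.univ.image f, ?_, ?_, ?_⟩
  · intro y hy
    obtain ⟨c, _, rfl⟩ := Finset.mem_image.1 hy
    exact hfD c
  · refine Finset.card_image_le.trans ?_
    rw [Finset.card_univ, Fintype.card_coe]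
    exact Finset.card_le_univ S
  · intro x hx
    obtain ⟨c, hc⟩ := hR x hx
    let c' : S := ⟨c, Finset.mem_filter.2 ⟨Finset.mem_univ _, x, hx, hc⟩⟩
    exact ⟨f c', Finset.mem_image_of_mem _ (Finset.mem_univ _), h x hx _ (hfD c') c hc (hfR c')⟩

/-- Cauchy–Schwarz on the support. Sparsity enters the Maurey argument only through this ℓ¹ bound.
-/
theorem sum_norm_le_of_mem_sparseBall {N s : ℕ} {x : Fin N → ℂ} (hx : x ∈ sparseBall N s) :
    ∑ j, ‖x j‖ ≤ Real.sqrt s := by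
  obtain ⟨h1, h2⟩ := hx
  refine Real.le_sqrt_of_sq_le ?_
  have e : ∑ j, ‖x j‖ = ∑ j ∈ Finset.univ.filter (fun i => x i ≠ 0), ‖x j‖ := by
    rw [Finset.sum_filter]
    refine Finset.sum_congr rfl fun j _ => ?_
    by_cases h : x j = 0 <;> simp [h]
  rw [e]
  refine (sq_sum_le_card_mul_sum_sq (f := fun j => ‖x j‖)).trans ?_
  have h3 : ∑ j ∈ Finset.univ.filter (fun i => x i ≠ 0), ‖x j‖ ^ 2 ≤ 1 :=
    (Finset.sum_le_sum_of_subset_of_nonneg (Finset.filter_subset _ _)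
      fun _ _ _ => by positivity).trans h2
  have h4 : ((Finset.univ.filter fun i => x i ≠ 0).card : ℝ) ≤ s := by exact_mod_cast h1
  calc _ ≤ (s : ℝ) * 1 := mul_le_mul h4 h3 (Finset.sum_nonneg fun _ _ => by positivity)
        (Nat.cast_nonneg s)
    _ = s := mul_one _

/-- The vertices `0`, `±e_j`, `±i e_j`, evaluated by the linear form with coefficients `v`. -/
noncomputable def vertexValue {N : ℕ} (v : Fin N → ℂ) : Option (Fin N × Bool × Bool) → ℂ
  | none => 0
  | some (j, false, false) => v j
  | some (j, false, true) => -v j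
  | some (j, true, false) => Complex.I * v j
  | some (j, true, true) => -(Complex.I * v j)

/-- The weights expressing `x / b` as a convex combination of the vertices. -/
noncomputable def vertexWeight {N : ℕ} (b : ℝ) (x : Fin N → ℂ) : Option (Fin N × Bool × Bool) → ℝ
  | none => 1 - ∑ j, (|(x j).re| + |(x j).im|) / b
  | some (j, false, false) => (|(x j).re| + (x j).re) / 2 / b
  | some (j, false, true) => (|(x j).re| - (x j).re) / 2 / b
  | some (j, true, false) => (|(x j).im| + (x j).im) / 2 / b
  | some (j, true, true) => (|(x j).im| - (x j).im) / 2 / b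

theorem norm_vertexValue_le {N : ℕ} {v : Fin N → ℂ} {K : ℝ} (hK : 0 ≤ K) (hv : ∀ j, ‖v j‖ ≤ K)
    (a : Option (Fin N × Bool × Bool)) : ‖vertexValue v a‖ ≤ K := by
  rcases a with _ | ⟨j, _ | _, _ | _⟩ <;> simp [vertexValue, hK, hv]

theorem vertexWeight_nonneg {N : ℕ} {b : ℝ} (hb : 0 < b) {x : Fin N → ℂ}
    (hx : ∑ j, (|(x j).re| + |(x j).im|) ≤ b) (a : Option (Fin N × Bool × Bool)) :
    0 ≤ vertexWeight b x a := by
  rcases a with _ | ⟨j, _ | _, _ | _⟩ <;> simp only [vertexWeight]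
  · rw [← Finset.sum_div, sub_nonneg]
    exact (div_le_one hb).2 hx
  all_goals
    refine div_nonneg (div_nonneg ?_ (by norm_num)) hb.le
    first
      | linarith [neg_abs_le (x j).re, le_abs_self (x j).re]
      | linarith [neg_abs_le (x j).im, le_abs_self (x j).im]

theorem sum_vertexWeight {N : ℕ} (b : ℝ) (x : Fin N → ℂ) : ∑ a, vertexWeight b x a = 1 := by
  rw [Fintype.sum_option, Fintype.sum_prod_type]
  simp only [Fintype.sum_prod_type, Fintype.sum_bool, vertexWeight]
  have : ∀ j, (|(x j).im| - (x j).im) / 2 / b + (|(x j).im| + (x j).im) / 2 / b +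
      ((|(x j).re| - (x j).re) / 2 / b + (|(x j).re| + (x j).re) / 2 / b) =
        (|(x j).re| + |(x j).im|) / b := fun j => by ring
  simp only [this]
  ring

theorem sum_vertexWeight_mul_value {N : ℕ} {b : ℝ} (hb : b ≠ 0) (x v : Fin N → ℂ) :
    ∑ a, (vertexWeight b x a : ℂ) * (b * vertexValue v a) = ∑ j, v j * x j := by
  have hb' : (b : ℂ) ≠ 0 := by exact_mod_cast hb
  rw [Fintype.sum_option, Fintype.sum_prod_type]
  simp only [Fintype.sum_prod_type, Fintype.sum_bool, vertexWeight, vertexValue]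
  simp only [mul_zero, zero_add]
  refine Finset.sum_congr rfl fun j _ => ?_
  conv_rhs => rw [← Complex.re_add_im (x j)]
  push_cast
  field_simp
  ring

/-- Covering of the sparse ball by Maurey's method, for the maximum of the linear forms given by
the rows of `V` in `J`. -/
theorem exists_net_maurey {N s : ℕ} {V : Matrix (Fin N) (Fin N) ℂ} {K : ℝ} (hK : 0 < K)
    (hV : ∀ i j, ‖V i j‖ ≤ K) (J : Finset (Fin N)) (hs : 0 < s) {r L : ℝ} (hr : 0 < r)
    (hL : 4 * J.card ≤ Real.exp L) {n : ℕ} (hn : 1024 * (s * K ^ 2 * L) ≤ n * r ^ 2) :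
    ∃ T : Finset (Fin N → ℂ), (∀ y ∈ T, y ∈ sparseBall N s) ∧ T.card ≤ (4 * N + 1) ^ n ∧
      ∀ x ∈ sparseBall N s, ∃ y ∈ T, ∀ i ∈ J, ‖V.mulVec x i - V.mulVec y i‖ ≤ r := by
  have hs' : (0 : ℝ) < s := by exact_mod_cast hs
  -- The ℓ¹ norm is at most √s, and real and imaginary parts, treated separately, cost a factor 2.
  set b : ℝ := 2 * Real.sqrt s with hb
  have hb0 : 0 < b := by positivity
  have hbsq : b ^ 2 = 4 * s := by rw [hb, mul_pow, Real.sq_sqrt hs'.le]; norm_num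
  -- An empty average cannot be divided by n. For n = 0 the hypothesis on n forces J = ∅, where one
  -- representative suffices.
  rcases Nat.eq_zero_or_pos n with rfl | hnpos
  · obtain ⟨T, h1, h2, h3⟩ := exists_finset_net (C := Unit) (sparseBall N s) (fun _ _ => True)
      (fun _ _ => J = ∅) (fun _ _ => ⟨(), trivial⟩) (fun _ _ _ _ _ _ _ => by
        by_contra hJ
        have hJ1 : (1 : ℝ) ≤ J.card := by
          exact_mod_cast Finset.card_pos.2 (Finset.nonempty_iff_ne_empty.2 hJ)
        have hLpos : 0 < L := by
          by_contra! hc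
          have := Real.exp_le_one_iff.2 hc
          linarith
        have : 0 < s * K ^ 2 * L := by positivity
        simp at hn
        linarith)
    refine ⟨T, h1, by simpa using h2, fun x hx => ?_⟩
    obtain ⟨y, hy, hJ⟩ := h3 x hx
    exact ⟨y, hy, by simp [hJ]⟩
  have hn0 : (0 : ℝ) < n := by exact_mod_cast hnpos
  let z : Option (Fin N × Bool × Bool) → J × Bool → ℝ := fun a i =>
    if i.2 then (b * vertexValue (V i.1) a).re else (b * vertexValue (V i.1) a).im
  have hz : ∀ a i, |z a i| ≤ b * K := fun a i => by
    have h1 : ‖(b : ℂ) * vertexValue (V i.1) a‖ ≤ b * K := by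
      rw [norm_mul, Complex.norm_real, Real.norm_of_nonneg hb0.le]
      exact mul_le_mul_of_nonneg_left (norm_vertexValue_le hK.le (fun j => hV _ j) a) hb0.le
    simp only [z]
    split_ifs
    · exact (Complex.abs_re_le_norm _).trans h1
    · exact (Complex.abs_im_le_norm _).trans h1
  -- The code of x is a sequence of n vertices whose average is r/4-close to it in each real and
  -- imaginary part. Two points with the same code differ by r/2 in each part, hence by r in
  -- modulus.
  obtain ⟨T, h1, h2, h3⟩ := exists_finset_net (C := Fin n → Option (Fin N × Bool × Bool))
    (sparseBall N s)
    (fun x c => ∀ i : J × Bool, |∑ k, z (c k) i - n * ∑ a, vertexWeight b x a * z a i| ≤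
      n * (r / 4))
    (fun x y => ∀ i ∈ J, ‖V.mulVec x i - V.mulVec y i‖ ≤ r)
    (fun x hx => by
      have hx1 : ∑ j, (|(x j).re| + |(x j).im|) ≤ b := by
        calc ∑ j, (|(x j).re| + |(x j).im|) ≤ ∑ j, 2 * ‖x j‖ :=
              Finset.sum_le_sum fun j _ => by
                linarith [Complex.abs_re_le_norm (x j), Complex.abs_im_le_norm (x j)]
          _ ≤ b := by
              rw [← Finset.mul_sum]
              exact mul_le_mul_of_nonneg_left (sum_norm_le_of_mem_sparseBall hx) (by norm_num)
      refine exists_seq_abs_sum_sub_le (L := L) (mul_pos hb0 hK) (by positivity) hz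
        (vertexWeight_nonneg hb0 hx1) (sum_vertexWeight b x) ?_ ?_
      · simp only [Fintype.card_prod, Fintype.card_coe, Fintype.card_bool]
        push_cast
        linarith
      · rw [mul_pow, hbsq]
        linarith)
    (fun x _ y _ c hx hy i hi => by
      have hmean : ∀ (u : Fin N → ℂ), ∑ a, (vertexWeight b u a : ℂ) * (b * vertexValue (V i) a) =
          V.mulVec u i := fun u => sum_vertexWeight_mul_value hb0.ne' u (V i)
      have hre : ∀ (u : Fin N → ℂ), ∑ a, vertexWeight b u a * z a (⟨i, hi⟩, true) =
          (V.mulVec u i).re := fun u => by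
        rw [← hmean, Complex.re_sum]
        simp only [z, if_true, Complex.re_ofReal_mul]
      have him : ∀ (u : Fin N → ℂ), ∑ a, vertexWeight b u a * z a (⟨i, hi⟩, false) =
          (V.mulVec u i).im := fun u => by
        rw [← hmean, Complex.im_sum]
        simp only [z, Bool.false_eq_true, if_false, Complex.im_ofReal_mul]
      have comb : ∀ {S p q : ℝ}, |S - n * p| ≤ n * (r / 4) → |S - n * q| ≤ n * (r / 4) →
          |p - q| ≤ r / 2 := by
        intro S p q hp hq
        have : |n * (p - q)| ≤ n * (r / 2) := by
          have e : n * (p - q) = (S - n * q) - (S - n * p) := by ring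
          rw [e]
          have := abs_sub (S - n * q) (S - n * p)
          linarith
        rw [abs_mul, abs_of_pos hn0] at this
        exact le_of_mul_le_mul_left this hn0
      have e1 := hx (⟨i, hi⟩, true)
      have e2 := hy (⟨i, hi⟩, true)
      have e3 := hx (⟨i, hi⟩, false)
      have e4 := hy (⟨i, hi⟩, false)
      rw [hre] at e1 e2
      rw [him] at e3 e4
      refine (Complex.norm_le_abs_re_add_abs_im _).trans ?_
      rw [Complex.sub_re, Complex.sub_im]
      linarith [comb e1 e2, comb e3 e4])
  refine ⟨T, h1, ?_, h3⟩
  simpa [mul_comm, mul_assoc, mul_left_comm, Fintype.card_option] using h2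

theorem norm_mulVec_le {N : ℕ} {V : Matrix (Fin N) (Fin N) ℂ} {K : ℝ}
    (hV : ∀ i j, ‖V i j‖ ≤ K) (x : Fin N → ℂ) (i : Fin N) :
    ‖V.mulVec x i‖ ≤ K * ∑ j, ‖x j‖ := by
  rw [Finset.mul_sum]
  refine (norm_sum_le Finset.univ fun j => V i j * x j).trans (Finset.sum_le_sum fun j _ => ?_)
  rw [norm_mul]
  exact mul_le_mul_of_nonneg_right (hV i j) (norm_nonneg _)

theorem abs_sub_le_of_floor_eq {a b c : ℝ} (hc : 0 < c) (h : ⌊c * a⌋ = ⌊c * b⌋) :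
    |a - b| ≤ 1 / c := by
  have h1 := Int.abs_sub_lt_one_of_floor_eq_floor h
  rw [← mul_sub, abs_mul, abs_of_pos hc] at h1
  rw [le_div_iff₀ hc]
  linarith

/-- A fine net of the sparse ball obtained by discretizing coordinates. -/
theorem exists_net_grid {N s : ℕ} {V : Matrix (Fin N) (Fin N) ℂ} {K : ℝ} (hK : 0 < K)
    (hV : ∀ i j, ‖V i j‖ ≤ K) (hsN : s ≤ N) (hN : 2 ≤ N) :
    ∃ T : Finset (Fin N → ℂ), (∀ y ∈ T, y ∈ sparseBall N s) ∧ T.card ≤ N ^ (11 * s) ∧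
      ∀ x ∈ sparseBall N s, ∃ y ∈ T, ∀ i, ‖V.mulVec x i - V.mulVec y i‖ ≤ K / N := by
  have hN0 : (0 : ℝ) < N := by exact_mod_cast (by omega : 0 < N)
  have : NeZero N := ⟨by omega⟩
  -- Mesh 1/c gives an error of 2/c = 1/N² per complex coordinate, hence at most 1/N in ℓ¹ over at
  -- most s ≤ N coordinates.
  let c : ℕ := 2 * N ^ 2
  have hc0 : (0 : ℝ) < c := by simp only [c]; positivity
  let box := Finset.Icc (-(c : ℤ)) c
  have hbox : ∀ {a : ℝ}, |a| ≤ 1 → ⌊(c : ℝ) * a⌋ ∈ box := by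
    intro a ha
    have ha' := abs_le.1 ha
    refine Finset.mem_Icc.2 ⟨Int.le_floor.2 ?_, ?_⟩
    · push_cast; nlinarith
    · have : ⌊(c : ℝ) * a⌋ ≤ ⌊(c : ℝ)⌋ := Int.floor_le_floor (by nlinarith)
      simpa using this
  obtain ⟨T, h1, h2, h3⟩ := exists_finset_net (C := Fin s → Fin N × box × box)
    (sparseBall N s)
    (fun x e => (∀ j, x j ≠ 0 → ∃ k, (e k).1 = j) ∧
      ∀ k, ⌊(c : ℝ) * (x (e k).1).re⌋ = ((e k).2.1 : ℤ) ∧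
        ⌊(c : ℝ) * (x (e k).1).im⌋ = ((e k).2.2 : ℤ))
    (fun x y => ∀ i, ‖V.mulVec x i - V.mulVec y i‖ ≤ K / N)
    (fun x hx => by
      have hnorm : ∀ j, ‖x j‖ ≤ 1 := fun j => by
        have h := (Finset.single_le_sum (f := fun i => ‖x i‖ ^ 2) (fun i _ => by positivity)
          (Finset.mem_univ j)).trans hx.2
        exact (sq_le_one_iff₀ (norm_nonneg _)).1 h
      obtain ⟨e, he⟩ : ∃ e : Fin s → Fin N, ∀ j, x j ≠ 0 → ∃ k, e k = j := by
        set S := Finset.univ.filter fun i => x i ≠ 0 with hS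
        have hcard : S.card ≤ s := hx.1
        -- Slots beyond the support size are padded with index 0. This is harmless, because the code
        -- also records the rounded coordinate there.
        refine ⟨fun k => if h : (k : ℕ) < S.card then S.equivFin.symm ⟨k, h⟩ else 0,
          fun j hj => ?_⟩
        have hjS : j ∈ S := Finset.mem_filter.2 ⟨Finset.mem_univ _, hj⟩
        have hlt := (S.equivFin ⟨j, hjS⟩).2
        refine ⟨⟨S.equivFin ⟨j, hjS⟩, hlt.trans_le hcard⟩, ?_⟩
        simp [hlt]
      exact ⟨fun k => (e k,
        ⟨_, hbox ((Complex.abs_re_le_norm (x (e k))).trans (hnorm _))⟩,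
        ⟨_, hbox ((Complex.abs_im_le_norm (x (e k))).trans (hnorm _))⟩), he, fun k => ⟨rfl, rfl⟩⟩)
    (fun x _ y _ e hx hy i => by
      have hxy : ∑ j, ‖(x - y) j‖ ≤ 1 / N := by
        have hk : ∀ k, ‖(x - y) (e k).1‖ ≤ 2 / c := fun k => by
          have e1 := abs_sub_le_of_floor_eq hc0 ((hx.2 k).1.trans (hy.2 k).1.symm)
          have e2 := abs_sub_le_of_floor_eq hc0 ((hx.2 k).2.trans (hy.2 k).2.symm)
          refine (Complex.norm_le_abs_re_add_abs_im _).trans ?_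
          rw [Pi.sub_apply, Complex.sub_re, Complex.sub_im]
          refine (add_le_add e1 e2).trans (le_of_eq ?_)
          ring
        have hzero : ∀ j ∉ Finset.univ.image fun k => (e k).1, ‖(x - y) j‖ = 0 := by
          intro j hj
          have hj' : ¬ ∃ k, (e k).1 = j := by simpa using hj
          have hxj : x j = 0 := by by_contra h; exact hj' (hx.1 j h)
          have hyj : y j = 0 := by by_contra h; exact hj' (hy.1 j h)
          simp [hxj, hyj]
        rw [← Finset.sum_subset (Finset.subset_univ (Finset.univ.image fun k => (e k).1))
          fun j _ hj => hzero j hj]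
        refine (Finset.sum_le_card_nsmul _ _ (2 / (c : ℝ)) ?_).trans ?_
        · intro j hj
          obtain ⟨k, _, rfl⟩ := Finset.mem_image.1 hj
          exact hk k
        · have hcard : ((Finset.univ.image fun k => (e k).1).card : ℝ) ≤ N := by
            have : (Finset.univ.image fun k => (e k).1).card ≤ s :=
              Finset.card_image_le.trans (by simp)
            exact_mod_cast this.trans hsN
          rw [nsmul_eq_mul]
          calc _ ≤ (N : ℝ) * (2 / c) := mul_le_mul_of_nonneg_right hcard (by positivity)
            _ = 1 / N := by simp only [c]; push_cast; field_simp
      rw [← Pi.sub_apply, ← Matrix.mulVec_sub]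
      refine (norm_mulVec_le hV _ i).trans ?_
      calc K * ∑ j, ‖(x - y) j‖ ≤ K * (1 / N) := mul_le_mul_of_nonneg_left hxy hK.le
        _ = K / N := by ring)
  refine ⟨T, h1, h2.trans ?_, h3⟩
  have hb : Fintype.card box ≤ N ^ 5 := by
    have e1 : Fintype.card box = 4 * N ^ 2 + 1 := by
      rw [Fintype.card_coe, Int.card_Icc, show (c : ℤ) + 1 - -c = ((4 * N ^ 2 + 1 : ℕ) : ℤ) by
        simp only [c]; push_cast; ring, Int.toNat_natCast]
    have h8 : 2 ^ 3 ≤ N ^ 3 := Nat.pow_le_pow_left hN 3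
    have h4 : 2 ^ 2 ≤ N ^ 2 := Nat.pow_le_pow_left hN 2
    have e2 : N ^ 5 = N ^ 2 * N ^ 3 := by ring
    rw [e1, e2]
    nlinarith
  rw [Fintype.card_fun, Fintype.card_prod, Fintype.card_prod, Fintype.card_fin, Fintype.card_fin,
    pow_mul]
  refine Nat.pow_le_pow_left ?_ s
  calc N * (Fintype.card box * Fintype.card box) ≤ N * (N ^ 5 * N ^ 5) := by gcongr
    _ = N ^ 11 := by ring

/-! ### Chaining for the sign process -/

/-- The process `x ↦ ∑_{i ∈ J} ± |(V x)_i|²` for given signs. -/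
noncomputable def signSum {N : ℕ} (V : Matrix (Fin N) (Fin N) ℂ) (J : Finset (Fin N))
    (x : Fin N → ℂ) (t : Fin N → Fin 2) : ℝ :=
  ∑ i ∈ J, fairSign (t i) * ‖V.mulVec x i‖ ^ 2

theorem abs_norm_sq_sub_norm_sq_le {E : Type*} [SeminormedAddCommGroup E] (a b : E) :
    |‖a‖ ^ 2 - ‖b‖ ^ 2| ≤ ‖a - b‖ * (‖a‖ + ‖b‖) := by
  have h : ‖a‖ ^ 2 - ‖b‖ ^ 2 = (‖a‖ - ‖b‖) * (‖a‖ + ‖b‖) := by ring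
  rw [h, abs_mul, abs_of_nonneg (by positivity : 0 ≤ ‖a‖ + ‖b‖)]
  exact mul_le_mul_of_nonneg_right (abs_norm_sub_norm_le a b) (by positivity)

section Chaining

variable {N s : ℕ} {V : Matrix (Fin N) (Fin N) ℂ} {J : Finset (Fin N)} {K ρ : ℝ}

/-- Since |a² − b²| ≤ r(a + b), the coefficients of the increment have square sum at most (2rρ)²,
and Hoeffding applies. -/
theorem cubeProb_signSum_sub_le {x y : Fin N → ℂ} {r u : ℝ} (hρ : 0 < ρ) (hr : 0 < r)
    (hu : 0 ≤ u) (hx : ∑ i ∈ J, ‖V.mulVec x i‖ ^ 2 ≤ ρ ^ 2)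
    (hy : ∑ i ∈ J, ‖V.mulVec y i‖ ^ 2 ≤ ρ ^ 2)
    (hxy : ∀ i ∈ J, ‖V.mulVec x i - V.mulVec y i‖ ≤ r) :
    cubeProb (1 / 2) {t | u < |signSum V J x t - signSum V J y t|} ≤
      2 * Real.exp (-(u ^ 2 / (8 * r ^ 2 * ρ ^ 2))) := by
  have key := cubeProb_rademacher_le
    (fun i => if i ∈ J then ‖V.mulVec x i‖ ^ 2 - ‖V.mulVec y i‖ ^ 2 else 0)
    (σ := 2 * r * ρ) (u := u) (by positivity) hu (by
      have h1 : ∀ i, (if i ∈ J then ‖V.mulVec x i‖ ^ 2 - ‖V.mulVec y i‖ ^ 2 else 0) ^ 2 =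
          if i ∈ J then (‖V.mulVec x i‖ ^ 2 - ‖V.mulVec y i‖ ^ 2) ^ 2 else 0 := fun i => by
        split_ifs <;> simp
      simp only [h1, Finset.sum_ite_mem, Finset.univ_inter]
      calc ∑ i ∈ J, (‖V.mulVec x i‖ ^ 2 - ‖V.mulVec y i‖ ^ 2) ^ 2
          ≤ ∑ i ∈ J, 2 * r ^ 2 * (‖V.mulVec x i‖ ^ 2 + ‖V.mulVec y i‖ ^ 2) := by
            refine Finset.sum_le_sum fun i hi => ?_
            set a := ‖V.mulVec x i‖
            set b := ‖V.mulVec y i‖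
            have h2 : |a ^ 2 - b ^ 2| ≤ r * (a + b) :=
              (abs_norm_sq_sub_norm_sq_le _ _).trans
                (mul_le_mul_of_nonneg_right (hxy i hi) (by positivity))
            have h3 : (a ^ 2 - b ^ 2) ^ 2 ≤ (r * (a + b)) ^ 2 :=
              sq_le_sq' (abs_le.1 h2).1 (abs_le.1 h2).2
            have h4 : (r * (a + b)) ^ 2 + r ^ 2 * (a - b) ^ 2 = 2 * r ^ 2 * (a ^ 2 + b ^ 2) := by
              ring
            have h5 : 0 ≤ r ^ 2 * (a - b) ^ 2 := by positivity
            linarith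
        _ = 2 * r ^ 2 *
            (∑ i ∈ J, ‖V.mulVec x i‖ ^ 2 + ∑ i ∈ J, ‖V.mulVec y i‖ ^ 2) := by
            rw [← Finset.mul_sum, Finset.sum_add_distrib]
        _ ≤ 2 * r ^ 2 * (ρ ^ 2 + ρ ^ 2) :=
            mul_le_mul_of_nonneg_left (add_le_add hx hy) (by positivity)
        _ = (2 * r * ρ) ^ 2 := by ring)
  refine le_trans (le_of_eq ?_) (key.trans (le_of_eq ?_))
  · congr 1
    ext t
    simp only [Set.mem_ofPred_eq, signSum, mul_ite, mul_zero, Finset.sum_ite_mem,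
      Finset.univ_inter, mul_sub, Finset.sum_sub_distrib]
  · ring_nf

/-- One link of the chain: passing from a net to a finer one. -/
theorem cubeProb_chain_step {T T' : Finset (Fin N → ℂ)} {r u U q Q l : ℝ} (hρ : 0 < ρ)
    (hr : 0 < r) (hu : 0 ≤ u)
    (hT : ∀ y ∈ T, ∑ i ∈ J, ‖V.mulVec y i‖ ^ 2 ≤ ρ ^ 2)
    (hT' : ∀ y ∈ T', ∑ i ∈ J, ‖V.mulVec y i‖ ^ 2 ≤ ρ ^ 2)
    (hnear : ∀ x ∈ T, ∃ y ∈ T', ∀ i ∈ J, ‖V.mulVec x i - V.mulVec y i‖ ≤ r)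
    (hU : cubeProb (1 / 2) {t | ∃ y ∈ T', U < |signSum V J y t|} ≤ Q)
    (hq : 2 * T.card ≤ q * Real.exp l) (hul : 8 * r ^ 2 * ρ ^ 2 * l ≤ u ^ 2) :
    cubeProb (1 / 2) {t | ∃ y ∈ T, U + u < |signSum V J y t|} ≤ Q + q := by
  -- Each point of the finer net is linked to a single coarser point, so the union bound runs over
  -- `T` and not over pairs.
  choose! f hfT hf using hnear
  have hsub : {t | ∃ y ∈ T, U + u < |signSum V J y t|} ⊆
      {t | ∃ y ∈ T', U < |signSum V J y t|} ∪
        {t | ∃ y ∈ T, t ∈ {t | u < |signSum V J y t - signSum V J (f y) t|}} := by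
    rintro t ⟨y, hy, h⟩
    by_cases hc : U < |signSum V J (f y) t|
    · exact Or.inl ⟨f y, hfT y hy, hc⟩
    · refine Or.inr ⟨y, hy, ?_⟩
      have h1 := abs_sub_abs_le_abs_sub (signSum V J y t) (signSum V J (f y) t)
      simp only [Set.mem_ofPred_eq]
      linarith
  refine (cubeProb_mono (by norm_num) (by norm_num) hsub).trans
    ((cubeProb_union_le (by norm_num) (by norm_num) _ _).trans (add_le_add hU ?_))
  refine (cubeProb_biUnion_le (by norm_num) (by norm_num) T _ (fun y hy =>
    cubeProb_signSum_sub_le hρ hr hu (hT y hy) (hT' _ (hfT y hy)) (hf y hy))).trans ?_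
  have h1 : Real.exp (-(u ^ 2 / (8 * r ^ 2 * ρ ^ 2))) ≤ Real.exp (-l) := by
    refine Real.exp_le_exp.2 (neg_le_neg ?_)
    rw [le_div_iff₀ (by positivity)]
    linarith
  calc (T.card : ℝ) * (2 * Real.exp (-(u ^ 2 / (8 * r ^ 2 * ρ ^ 2))))
      ≤ T.card * (2 * Real.exp (-l)) := by gcongr
    _ = 2 * T.card * Real.exp (-l) := by ring
    _ ≤ q * Real.exp l * Real.exp (-l) := mul_le_mul_of_nonneg_right hq (Real.exp_pos _).le
    _ = q := by rw [mul_assoc, ← Real.exp_add]; simp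

theorem zero_mem_sparseBall : (0 : Fin N → ℂ) ∈ sparseBall N s := by
  simp [sparseBall]

/-- The part of the chain consisting of Maurey nets at dyadic scales. -/
theorem exists_chain_maurey (hK : 0 < K) (hV : ∀ i j, ‖V i j‖ ≤ K) (hs : 0 < s) (hN : 2 ≤ N)
    (hρ : 0 < ρ) (hJ : ∀ x ∈ sparseBall N s, ∑ i ∈ J, ‖V.mulVec x i‖ ^ 2 ≤ ρ ^ 2)
    {l H q β : ℝ} (hl : 1 ≤ l) (hlJ : 4 * J.card ≤ Real.exp l) (hH : 0 ≤ H)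
    (hHl : 4100 * (s * K ^ 2 * l * Real.log N) ≤ H ^ 2) (hβ : 0 ≤ β)
    (hqβ : 2 ≤ q * Real.exp (β ^ 2)) (k : ℕ) :
    ∃ T : Finset (Fin N → ℂ), (∀ y ∈ T, y ∈ sparseBall N s) ∧
      (∀ x ∈ sparseBall N s, ∃ y ∈ T, ∀ i ∈ J,
        ‖V.mulVec x i - V.mulVec y i‖ ≤ Real.sqrt s * K / 2 ^ k) ∧
      cubeProb (1 / 2) {t | ∃ y ∈ T, 6 * ρ * (k * H + Real.sqrt s * K * (1 - 1 / 2 ^ k) * β) <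
        |signSum V J y t|} ≤ k * q := by
  have hs' : (0 : ℝ) < s := by exact_mod_cast hs
  have hN1 : (1 : ℝ) < N := by exact_mod_cast (by omega : 1 < N)
  have hlogN : 0 < Real.log N := Real.log_pos hN1
  induction k with
  | zero =>
    -- At scale √s K the origin alone is a net, and the process vanishes there.
    refine ⟨{0}, by simpa using zero_mem_sparseBall, fun x hx => ⟨0, by simp, fun i _ => ?_⟩, ?_⟩
    · have h1 := norm_mulVec_le hV x i
      have h2 := mul_le_mul_of_nonneg_left (sum_norm_le_of_mem_sparseBall hx) hK.le
      simp only [Matrix.mulVec_zero, Pi.zero_apply, sub_zero, pow_zero, div_one]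
      linarith
    · rw [Nat.cast_zero, zero_mul q]
      refine le_of_eq ((congrArg (cubeProb _) ?_).trans (cubeProb_empty _))
      ext t
      simp [signSum]
  | succ k ih =>
    obtain ⟨T', hT'D, hT'n, hT'P⟩ := ih
    set r : ℝ := Real.sqrt s * K / 2 ^ (k + 1) with hr
    have hr0 : 0 < r := by positivity
    have hr2 : Real.sqrt s * K / 2 ^ k = 2 * r := by rw [hr, pow_succ]; field_simp
    have hrsq : r ^ 2 = s * K ^ 2 / 4 ^ (k + 1) := by
      rw [hr, div_pow, mul_pow, Real.sq_sqrt hs'.le, ← pow_mul, mul_comm (k + 1) 2, pow_mul]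
      norm_num
    have h4 : (1 : ℝ) ≤ 4 ^ (k + 1) := one_le_pow₀ (by norm_num)
    -- Maurey length at scale r = √s K / 2^(k+1). As n grows like 1/r², the product r² · 4n log N is
    -- bounded by H² independently of k, so every scale costs the same.
    set n : ℕ := ⌈1024 * 4 ^ (k + 1) * l⌉₊ with hn
    have hn1 : 1024 * 4 ^ (k + 1) * l ≤ (n : ℝ) := Nat.le_ceil _
    have hn2 : (n : ℝ) ≤ 1025 * 4 ^ (k + 1) * l := by
      have := (Nat.ceil_lt_add_one (by positivity : 0 ≤ 1024 * 4 ^ (k + 1) * l)).le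
      nlinarith
    obtain ⟨T, hTD, hTc, hTn⟩ := exists_net_maurey (n := n) hK hV J hs hr0 hlJ (by
      rw [hrsq]
      calc 1024 * (s * K ^ 2 * l) = 1024 * 4 ^ (k + 1) * l * (s * K ^ 2 / 4 ^ (k + 1)) := by
            field_simp
        _ ≤ n * (s * K ^ 2 / 4 ^ (k + 1)) := mul_le_mul_of_nonneg_right hn1 (by positivity))
    refine ⟨T, hTD, hTn, ?_⟩
    -- The link has length 2r, the scale of the previous net. The exponent 4n log N pays for the
    -- cardinality and β² for the probability q.
    have hstep := cubeProb_chain_step (u := 6 * ρ * (H + r * β)) (q := q)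
      (l := 4 * n * Real.log N + β ^ 2) hρ (by positivity : 0 < 2 * r) (by positivity)
      (fun y hy => hJ y (hTD y hy)) (fun y hy => hJ y (hT'D y hy))
      (fun x hx => by rw [← hr2]; exact hT'n x (hTD x hx)) hT'P ?_ ?_
    · refine le_trans (le_of_eq ?_) (hstep.trans (le_of_eq ?_))
      · congr 1
        ext t
        have e : 6 * ρ * (((k + 1 : ℕ) : ℝ) * H + Real.sqrt s * K * (1 - 1 / 2 ^ (k + 1)) * β) =
            6 * ρ * (k * H + Real.sqrt s * K * (1 - 1 / 2 ^ k) * β) + 6 * ρ * (H + r * β) := by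
          rw [hr, pow_succ]; push_cast; field_simp; ring
        rw [e]
      · push_cast; ring
    · have hc1 : (T.card : ℝ) ≤ Real.exp (4 * n * Real.log N) := by
        have h9 : (4 * N + 1) ^ n ≤ (N ^ 4) ^ n := by
          refine Nat.pow_le_pow_left ?_ n
          have h8 : 2 ^ 3 ≤ N ^ 3 := Nat.pow_le_pow_left hN 3
          have e2 : N ^ 4 = N * N ^ 3 := by ring
          rw [e2]; nlinarith
        have h10 : (T.card : ℝ) ≤ ((N : ℝ) ^ 4) ^ n := by exact_mod_cast hTc.trans h9
        refine h10.trans (le_of_eq ?_)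
        rw [← pow_mul, ← Real.exp_log (by positivity : (0 : ℝ) < (N : ℝ) ^ (4 * n)), Real.log_pow]
        push_cast; rfl
      calc 2 * (T.card : ℝ) ≤ q * Real.exp (β ^ 2) * Real.exp (4 * n * Real.log N) :=
            mul_le_mul hqβ hc1 (by positivity) (by linarith)
        _ = q * Real.exp (4 * n * Real.log N + β ^ 2) := by rw [Real.exp_add]; ring
    · have e1 : r ^ 2 * (4 * n * Real.log N) ≤ H ^ 2 := by
        refine le_trans ?_ hHl
        rw [hrsq]
        calc s * K ^ 2 / 4 ^ (k + 1) * (4 * n * Real.log N)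
            ≤ s * K ^ 2 / 4 ^ (k + 1) * (4 * (1025 * 4 ^ (k + 1) * l) * Real.log N) := by gcongr
          _ = 4100 * (s * K ^ 2 * l * Real.log N) := by field_simp; ring
      have e2 : 8 * (2 * r) ^ 2 * ρ ^ 2 * (4 * n * Real.log N + β ^ 2) =
          32 * ρ ^ 2 * (r ^ 2 * (4 * n * Real.log N) + (r * β) ^ 2) := by ring
      have e3 : (6 * ρ * (H + r * β)) ^ 2 =
          36 * ρ ^ 2 * (H ^ 2 + (r * β) ^ 2) + 72 * ρ ^ 2 * (H * (r * β)) := by ring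
      have e4 : 0 ≤ 72 * ρ ^ 2 * (H * (r * β)) := by positivity
      have e5 : 32 * ρ ^ 2 * (r ^ 2 * (4 * n * Real.log N) + (r * β) ^ 2) ≤
          36 * ρ ^ 2 * (H ^ 2 + (r * β) ^ 2) := by gcongr; norm_num
      rw [e2, e3]
      linarith

theorem sum_norm_mulVec_le {x : Fin N → ℂ} (hρ : 0 ≤ ρ)
    (hx : ∑ i ∈ J, ‖V.mulVec x i‖ ^ 2 ≤ ρ ^ 2) : ∑ i ∈ J, ‖V.mulVec x i‖ ≤ N * ρ := by
  refine le_of_sq_le_sq ?_ (by positivity)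
  refine (sq_sum_le_card_mul_sum_sq (f := fun i => ‖V.mulVec x i‖)).trans ?_
  have h1 : (J.card : ℝ) ≤ N := by
    have := Finset.card_le_univ J
    rw [Fintype.card_fin] at this
    exact_mod_cast this
  have h2 : (N : ℝ) ≤ N ^ 2 := by
    have : N ≤ N ^ 2 := Nat.le_self_pow (by norm_num) N
    exact_mod_cast this
  rw [mul_pow]
  exact mul_le_mul (h1.trans h2) hx (Finset.sum_nonneg fun _ _ => by positivity) (by positivity)

/-- Tail bound for the supremum of the sign process over the sparse ball. -/
theorem cubeProb_sup_signSum_le (hK : 0 < K) (hV : ∀ i j, ‖V i j‖ ≤ K) (hs : 0 < s)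
    (hsN : s ≤ N) (hN : 2 ≤ N)
    (hρ : 0 < ρ) (hJ : ∀ x ∈ sparseBall N s, ∑ i ∈ J, ‖V.mulVec x i‖ ^ 2 ≤ ρ ^ 2)
    {l H q β : ℝ} (hl : 1 ≤ l) (hlJ : 4 * J.card ≤ Real.exp l) (hH : 0 ≤ H)
    (hHl : 4100 * (s * K ^ 2 * l * Real.log N) ≤ H ^ 2) (hβ : 0 ≤ β)
    (hqβ : 2 ≤ q * Real.exp (β ^ 2)) {k : ℕ} (hk : s ≤ 2 ^ k) :
    cubeProb (1 / 2) {t | ∃ x ∈ sparseBall N s,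
        (6 * k * H + 9 * Real.sqrt s * K * β + 10 * K * Real.sqrt (Real.log N) + 2 * K) * ρ <
          |signSum V J x t|} ≤ (k + 1) * q := by
  have hs' : (0 : ℝ) < s := by exact_mod_cast hs
  have hN1 : (1 : ℝ) < N := by exact_mod_cast (by omega : 1 < N)
  have hN0 : (0 : ℝ) < N := by linarith
  have hlogN : 0 < Real.log N := Real.log_pos hN1
  obtain ⟨T', hT'D, hT'n, hT'P⟩ := exists_chain_maurey hK hV hs hN hρ hJ hl hlJ hH hHl hβ hqβ k
  obtain ⟨T, hTD, hTc, hTn⟩ := exists_net_grid hK hV hsN hN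
  set r : ℝ := Real.sqrt s * K / 2 ^ k with hr
  have hr0 : 0 < r := by positivity
  have hk' : (s : ℝ) ≤ 2 ^ k := by exact_mod_cast hk
  have h2k : (1 : ℝ) ≤ 2 ^ k := one_le_pow₀ (by norm_num)
  -- The reason to stop once 2^k ≥ s: the grid entropy 11 s log N, weighted by r², then costs only
  -- K² log N. This yields log s scales rather than log N.
  have hrs : r ^ 2 * s ≤ K ^ 2 := by
    have e : r ^ 2 * s = K ^ 2 * (s ^ 2 / (2 ^ k) ^ 2) := by
      rw [hr, div_pow, mul_pow, Real.sq_sqrt hs'.le]; ring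
    rw [e]
    refine mul_le_of_le_one_right (by positivity) ?_
    rw [div_le_one (by positivity)]
    exact pow_le_pow_left₀ hs'.le hk' 2
  have hr1 : r ≤ Real.sqrt s * K := div_le_self (by positivity) h2k
  set g : ℝ := Real.sqrt (Real.log N) with hg
  have hg2 : g ^ 2 = Real.log N := Real.sq_sqrt hlogN.le
  have hstep := cubeProb_chain_step (u := (10 * K * g + 3 * Real.sqrt s * K * β) * ρ) (q := q)
    (l := 11 * s * Real.log N + β ^ 2) hρ hr0 (by positivity)
    (fun y hy => hJ y (hTD y hy)) (fun y hy => hJ y (hT'D y hy))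
    (fun x hx => hT'n x (hTD x hx)) hT'P ?_ ?_
  · have e : (k : ℝ) * q + q = (k + 1) * q := by ring
    rw [← e]
    refine (cubeProb_mono (by norm_num) (by norm_num) ?_).trans hstep
    rintro t ⟨x, hx, ht⟩
    obtain ⟨y, hy, hxy⟩ := hTn x hx
    refine ⟨y, hy, ?_⟩
    have hdiff : |signSum V J x t - signSum V J y t| ≤ 2 * K * ρ := by
      have e1 : signSum V J x t - signSum V J y t =
          ∑ i ∈ J, fairSign (t i) * (‖V.mulVec x i‖ ^ 2 - ‖V.mulVec y i‖ ^ 2) := by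
        simp only [signSum, mul_sub, Finset.sum_sub_distrib]
      rw [e1]
      have e2 : ∀ a, |fairSign a| = 1 := fun a => by
        unfold fairSign; split_ifs <;> simp
      calc |∑ i ∈ J, fairSign (t i) * (‖V.mulVec x i‖ ^ 2 - ‖V.mulVec y i‖ ^ 2)|
          ≤ ∑ i ∈ J, K / N * (‖V.mulVec x i‖ + ‖V.mulVec y i‖) := by
            refine (Finset.abs_sum_le_sum_abs _ _).trans (Finset.sum_le_sum fun i _ => ?_)
            rw [abs_mul, e2, one_mul]
            exact (abs_norm_sq_sub_norm_sq_le _ _).trans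
              (mul_le_mul_of_nonneg_right (hxy i) (by positivity))
        _ = K / N * (∑ i ∈ J, ‖V.mulVec x i‖ + ∑ i ∈ J, ‖V.mulVec y i‖) := by
            rw [← Finset.mul_sum, Finset.sum_add_distrib]
        _ ≤ K / N * (N * ρ + N * ρ) :=
            mul_le_mul_of_nonneg_left (add_le_add (sum_norm_mulVec_le hρ.le (hJ x hx))
              (sum_norm_mulVec_le hρ.le (hJ y (hTD y hy)))) (by positivity)
        _ = 2 * K * ρ := by field_simp; ring
    have h1 := abs_sub_abs_le_abs_sub (signSum V J x t) (signSum V J y t)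
    have h2 : 6 * ρ * (k * H + Real.sqrt s * K * (1 - 1 / 2 ^ k) * β) ≤
        6 * ρ * (k * H + Real.sqrt s * K * 1 * β) := by
      have : 1 - 1 / 2 ^ k ≤ (1 : ℝ) := by
        have : (0 : ℝ) < 1 / 2 ^ k := by positivity
        linarith
      gcongr
    have h3 : (6 * k * H + 9 * Real.sqrt s * K * β + 10 * K * g + 2 * K) * ρ =
        6 * ρ * (k * H + Real.sqrt s * K * 1 * β) + (10 * K * g + 3 * Real.sqrt s * K * β) * ρ +
          2 * K * ρ := by ring
    linarith
  · have hc1 : (T.card : ℝ) ≤ Real.exp (11 * s * Real.log N) := by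
      have h10 : (T.card : ℝ) ≤ (N : ℝ) ^ (11 * s) := by exact_mod_cast hTc
      refine h10.trans (le_of_eq ?_)
      rw [← Real.exp_log (by positivity : (0 : ℝ) < (N : ℝ) ^ (11 * s)), Real.log_pow]
      push_cast; rfl
    calc 2 * (T.card : ℝ) ≤ q * Real.exp (β ^ 2) * Real.exp (11 * s * Real.log N) :=
          mul_le_mul hqβ hc1 (by positivity) (by linarith)
      _ = q * Real.exp (11 * s * Real.log N + β ^ 2) := by rw [Real.exp_add]; ring
  · have e1 : 8 * r ^ 2 * ρ ^ 2 * (11 * s * Real.log N + β ^ 2) =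
        ρ ^ 2 * (88 * (r ^ 2 * s) * Real.log N + 8 * r ^ 2 * β ^ 2) := by ring
    have e2 : ((10 * K * g + 3 * Real.sqrt s * K * β) * ρ) ^ 2 =
        ρ ^ 2 * (100 * K ^ 2 * Real.log N + 9 * (Real.sqrt s * K) ^ 2 * β ^ 2) +
          ρ ^ 2 * (60 * K * g * (Real.sqrt s * K * β)) := by rw [← hg2]; ring
    have e3 : 0 ≤ ρ ^ 2 * (60 * K * g * (Real.sqrt s * K * β)) := by positivity
    have e4 : ρ ^ 2 * (88 * (r ^ 2 * s) * Real.log N + 8 * r ^ 2 * β ^ 2) ≤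
        ρ ^ 2 * (100 * K ^ 2 * Real.log N + 9 * (Real.sqrt s * K) ^ 2 * β ^ 2) := by
      gcongr <;> norm_num
    rw [e1, e2]
    linarith

end Chaining

/-! ### Symmetrization -/

/-- The product Bernoulli probability of a set of pairs of independent points of the cube. -/
noncomputable def pairProb {ι : Type*} [Fintype ι] [DecidableEq ι] (p : ℝ)
    (E : Set ((ι → Fin 2) × (ι → Fin 2))) : ℝ :=
  ∑ z, E.indicator (fun z => cubeWeight p z.1 * cubeWeight p z.2) z

/-- Exchange the two points of a pair in the coordinates where `e` is not `1`. -/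
def swapPair {ι : Type*} (e : ι → Fin 2) (z : (ι → Fin 2) × (ι → Fin 2)) :
    (ι → Fin 2) × (ι → Fin 2) :=
  (fun i => if e i = 1 then z.1 i else z.2 i, fun i => if e i = 1 then z.2 i else z.1 i)

theorem swapPair_involutive {ι : Type*} (e : ι → Fin 2) : Function.Involutive (swapPair e) := by
  intro z
  ext i <;> by_cases h : e i = 1 <;> simp [swapPair, h]

section Pairs

variable {ι : Type*} [Fintype ι] [DecidableEq ι] {p : ℝ}

theorem pairProb_eq_sum (E : Set ((ι → Fin 2) × (ι → Fin 2))) :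
    pairProb p E = ∑ t, cubeWeight p t * cubeProb p {t' | (t, t') ∈ E} := by
  rw [pairProb, Fintype.sum_prod_type]
  refine Finset.sum_congr rfl fun t _ => ?_
  rw [cubeProb, Finset.mul_sum]
  refine Finset.sum_congr rfl fun t' _ => ?_
  by_cases h : (t, t') ∈ E <;> simp [h]

theorem pairProb_mono (h0 : 0 ≤ p) (h1 : p ≤ 1) {E F : Set ((ι → Fin 2) × (ι → Fin 2))}
    (h : E ⊆ F) : pairProb p E ≤ pairProb p F :=
  Finset.sum_le_sum fun z _ => Set.indicator_le_indicator_of_subset h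
    (fun z => mul_nonneg (cubeWeight_nonneg h0 h1 z.1) (cubeWeight_nonneg h0 h1 z.2)) z

theorem pairProb_union_le (h0 : 0 ≤ p) (h1 : p ≤ 1) (E F : Set ((ι → Fin 2) × (ι → Fin 2))) :
    pairProb p (E ∪ F) ≤ pairProb p E + pairProb p F := by
  rw [pairProb, pairProb, pairProb, ← Finset.sum_add_distrib]
  refine Finset.sum_le_sum fun z _ => ?_
  have := mul_nonneg (cubeWeight_nonneg h0 h1 z.1) (cubeWeight_nonneg h0 h1 z.2)
  by_cases hA : z ∈ E <;> by_cases hB : z ∈ F <;> simp [hA, hB, this]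

theorem pairProb_fst (A : Set (ι → Fin 2)) :
    pairProb p {z : (ι → Fin 2) × (ι → Fin 2) | z.1 ∈ A} = cubeProb p A := by
  rw [pairProb_eq_sum, cubeProb]
  refine Finset.sum_congr rfl fun t _ => ?_
  by_cases h : t ∈ A
  · have : {t' : ι → Fin 2 | (t, t') ∈ {z : (ι → Fin 2) × (ι → Fin 2) | z.1 ∈ A}} = Set.univ := by
      ext; simp [h]
    rw [this, cubeProb_univ]; simp [h]
  · have : {t' : ι → Fin 2 | (t, t') ∈ {z : (ι → Fin 2) × (ι → Fin 2) | z.1 ∈ A}} = ∅ := by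
      ext; simp [h]
    rw [this, cubeProb_empty]; simp [h]

theorem pairProb_snd (A : Set (ι → Fin 2)) :
    pairProb p {z : (ι → Fin 2) × (ι → Fin 2) | z.2 ∈ A} = cubeProb p A := by
  rw [pairProb_eq_sum]
  change ∑ t, cubeWeight p t * cubeProb p A = _
  rw [← Finset.sum_mul, sum_cubeWeight, one_mul]

/-- Fubini: above each point of `A` the section of `E` carries at least half of the mass. -/
theorem cubeProb_le_two_mul_pairProb (h0 : 0 ≤ p) (h1 : p ≤ 1) {A : Set (ι → Fin 2)}
    {E : Set ((ι → Fin 2) × (ι → Fin 2))}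
    (h : ∀ t ∈ A, 1 / 2 ≤ cubeProb p {t' | (t, t') ∈ E}) :
    cubeProb p A ≤ 2 * pairProb p E := by
  rw [pairProb_eq_sum, Finset.mul_sum]
  refine Finset.sum_le_sum fun t _ => ?_
  have hw := cubeWeight_nonneg h0 h1 t
  by_cases ht : t ∈ A
  · have := mul_le_mul_of_nonneg_left (h t ht) hw
    simp only [Set.indicator_of_mem ht]
    linarith
  · simp only [Set.indicator_of_notMem ht]
    have := mul_nonneg hw (cubeProb_nonneg h0 h1 {t' | (t, t') ∈ E})
    linarith

-- The two points have the same law in each coordinate, so random exchanges preserve the law of the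
-- pair.
omit [DecidableEq ι] in
theorem cubeWeight_swapPair (e : ι → Fin 2) (z : (ι → Fin 2) × (ι → Fin 2)) :
    cubeWeight p (swapPair e z).1 * cubeWeight p (swapPair e z).2 =
      cubeWeight p z.1 * cubeWeight p z.2 := by
  simp only [cubeWeight, ← Finset.prod_mul_distrib]
  refine Finset.prod_congr rfl fun i _ => ?_
  by_cases h : e i = 1
  · simp [swapPair, h]
  · simp [swapPair, h, mul_comm]

/-- Symmetrization: a set of pairs is unlikely if it is unlikely under random exchanges. -/
theorem pairProb_le_of_swapPair (h0 : 0 ≤ p) (h1 : p ≤ 1) {E : Set ((ι → Fin 2) × (ι → Fin 2))}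
    {q : ℝ} (h : ∀ z, cubeProb (1 / 2) {e | swapPair e z ∈ E} ≤ q) : pairProb p E ≤ q := by
  set W : (ι → Fin 2) × (ι → Fin 2) → ℝ := fun z => cubeWeight p z.1 * cubeWeight p z.2 with hW
  have hW0 : ∀ z, 0 ≤ W z := fun z =>
    mul_nonneg (cubeWeight_nonneg h0 h1 z.1) (cubeWeight_nonneg h0 h1 z.2)
  have hW1 : ∑ z, W z = 1 := by
    rw [Fintype.sum_prod_type]
    simp only [hW, ← Finset.mul_sum, sum_cubeWeight, mul_one]
  have hsw : ∀ e, ∑ z, W z * E.indicator 1 (swapPair e z) = pairProb p E := fun e => by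
    rw [pairProb]
    refine Eq.trans ?_ (Equiv.sum_comp (swapPair_involutive e).toPerm _)
    refine Finset.sum_congr rfl fun z _ => ?_
    simp only [Function.Involutive.coe_toPerm]
    have := cubeWeight_swapPair (p := p) e z
    by_cases hz : swapPair e z ∈ E <;> simp [hz, hW, this]
  calc pairProb p E = ∑ e : ι → Fin 2, cubeWeight (1 / 2) e * pairProb p E := by
        rw [← Finset.sum_mul, sum_cubeWeight, one_mul]
    _ = ∑ e : ι → Fin 2, cubeWeight (1 / 2) e * ∑ z, W z * E.indicator 1 (swapPair e z) := by
        simp only [hsw]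
    _ = ∑ z, W z * cubeProb (1 / 2) {e | swapPair e z ∈ E} := by
        simp only [Finset.mul_sum, cubeProb]
        rw [Finset.sum_comm]
        refine Finset.sum_congr rfl fun z _ => Finset.sum_congr rfl fun e _ => ?_
        by_cases hz : swapPair e z ∈ E <;> simp [hz, mul_comm]
    _ ≤ ∑ z, W z * q := Finset.sum_le_sum fun z _ => mul_le_mul_of_nonneg_left (h z) (hW0 z)
    _ = q := by rw [← Finset.sum_mul, hW1, one_mul]

/-- At parameter 1/2 the weight is uniform, so any relabelling of signs preserves probabilities. -/
theorem cubeProb_half_preimage (e : Equiv.Perm (ι → Fin 2)) (A : Set (ι → Fin 2)) :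
    cubeProb (1 / 2) (e ⁻¹' A) = cubeProb (1 / 2) A := by
  have hw : ∀ t : ι → Fin 2, cubeWeight (1 / 2) t = ∏ _i : ι, (1 / 2 : ℝ) := fun t =>
    Finset.prod_congr rfl fun i _ => by split_ifs <;> norm_num
  rw [cubeProb, cubeProb]
  refine Eq.trans (Finset.sum_congr rfl fun t _ => ?_) (Equiv.sum_comp e _)
  by_cases h : e t ∈ A
  · rw [Set.indicator_of_mem h, Set.indicator_of_mem (show t ∈ e ⁻¹' A from h), hw, hw]
  · rw [Set.indicator_of_notMem h, Set.indicator_of_notMem (show t ∉ e ⁻¹' A from h)]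

end Pairs

/-- The deviation of the rescaled sampled energy of `V x` from the energy of `x`. -/
noncomputable def sampleDeviation {N : ℕ} (V : Matrix (Fin N) (Fin N) ℂ) (m : ℝ)
    (x : Fin N → ℂ) (t : Fin N → Fin 2) : ℝ :=
  m⁻¹ * ∑ i, (if t i = 1 then ‖V.mulVec x i‖ ^ 2 else 0) - ∑ j, ‖x j‖ ^ 2

/-! ### Symmetrized deviations and the doubling inequality -/

section Symmetrization

variable {N s : ℕ} {V : Matrix (Fin N) (Fin N) ℂ} {m A q : ℝ}

/-- The random signs of an exchanged pair, as a process in `x`. -/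
theorem sampleDeviation_swapPair_sub (x : Fin N → ℂ) (e : Fin N → Fin 2)
    (z : (Fin N → Fin 2) × (Fin N → Fin 2)) :
    sampleDeviation V m x (swapPair e z).1 - sampleDeviation V m x (swapPair e z).2 =
      m⁻¹ * signSum V (Finset.univ.filter fun i => z.1 i ≠ z.2 i) x
        (fun i => if z.1 i = 1 then e i else 1 - e i) := by
  simp only [sampleDeviation, signSum, sub_sub_sub_cancel_right, ← mul_sub,
    ← Finset.sum_sub_distrib, Finset.sum_filter]
  congr 1
  refine Finset.sum_congr rfl fun i _ => ?_
  simp only [swapPair]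
  have h01 : ∀ a : Fin 2, a = 0 ∨ a = 1 := by decide
  rcases h01 (z.1 i) with h1 | h1 <;> rcases h01 (z.2 i) with h2 | h2 <;>
    rcases h01 (e i) with h3 | h3 <;> simp [fairSign, h1, h2, h3]

theorem involutive_flip (z : Fin N → Fin 2) :
    Function.Involutive fun (t : Fin N → Fin 2) i => if z i = 1 then t i else 1 - t i := by
  intro t
  funext i
  by_cases h : z i = 1 <;> simp [h]

/-- Exchanges do not change the set where the two points differ, so the size and energy conditions
depend on the pair alone. For a fixed pair the difference of deviations is m⁻¹ times a sign process
on that set, up to flipping fair signs. -/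
theorem pairProb_symmetrized_le {p ρ τ : ℝ} (h0 : 0 ≤ p) (h1 : p ≤ 1) (hm : 0 < m) (hq : 0 ≤ q)
    (hρ : A * ρ ≤ m * τ)
    (hsign : ∀ J : Finset (Fin N), J.card ≤ 6 * m →
      (∀ x ∈ sparseBall N s, ∑ i ∈ J, ‖V.mulVec x i‖ ^ 2 ≤ ρ ^ 2) →
      cubeProb (1 / 2) {t | ∃ x ∈ sparseBall N s, A * ρ < |signSum V J x t|} ≤ q) :
    pairProb p {z | (∃ x ∈ sparseBall N s,
        τ < |sampleDeviation V m x z.1 - sampleDeviation V m x z.2|) ∧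
      ((Finset.univ.filter fun i => z.1 i ≠ z.2 i).card : ℝ) ≤ 6 * m ∧
      ∀ x ∈ sparseBall N s, ∑ i with z.1 i ≠ z.2 i, ‖V.mulVec x i‖ ^ 2 ≤ ρ ^ 2} ≤ q := by
  refine pairProb_le_of_swapPair h0 h1 fun z => ?_
  have hJ : ∀ e, (Finset.univ.filter fun i => (swapPair e z).1 i ≠ (swapPair e z).2 i) =
      Finset.univ.filter fun i => z.1 i ≠ z.2 i := fun e => by
    refine Finset.filter_congr fun i _ => ?_
    by_cases h : e i = 1
    · simp [swapPair, h]
    · simp [swapPair, h, eq_comm]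
  simp only [Set.mem_ofPred_eq, hJ]
  by_cases hz : ((Finset.univ.filter fun i => z.1 i ≠ z.2 i).card : ℝ) ≤ 6 * m ∧
      ∀ x ∈ sparseBall N s, ∑ i with z.1 i ≠ z.2 i, ‖V.mulVec x i‖ ^ 2 ≤ ρ ^ 2
  · refine le_trans ?_ ((cubeProb_half_preimage (involutive_flip z.1).toPerm _).le.trans
      (hsign _ hz.1 hz.2))
    refine cubeProb_mono (by norm_num) (by norm_num) ?_
    rintro e ⟨⟨x, hx, hlt⟩, _⟩
    refine ⟨x, hx, ?_⟩
    rw [sampleDeviation_swapPair_sub, abs_mul, abs_of_pos (inv_pos.2 hm), inv_mul_eq_div,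
      lt_div_iff₀ hm] at hlt
    exact hρ.trans_lt (by rwa [mul_comm])
  · refine le_trans (le_of_eq ?_) hq
    refine (congrArg (cubeProb _) ?_).trans (cubeProb_empty _)
    ext e
    simp only [Set.mem_ofPred_eq, Set.mem_empty_iff_false, iff_false]
    exact fun h => hz h.2

theorem sum_mulVec_le_of_sampleDeviation_le {x : Fin N → ℂ} {t : Fin N → Fin 2} {τ : ℝ}
    (hm : 0 < m) (hx : ∑ j, ‖x j‖ ^ 2 ≤ 1) (h : |sampleDeviation V m x t| ≤ τ) :
    ∑ i, (if t i = 1 then ‖V.mulVec x i‖ ^ 2 else 0) ≤ m * (1 + τ) := by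
  have h1 := (abs_le.1 h).2
  rw [sampleDeviation, inv_mul_eq_div] at h1
  rw [← div_le_iff₀' hm]
  linarith

/-- The doubling inequality for the tail of the supremum of the deviation. -/
theorem cubeProb_sup_sampleDeviation_doubling {p τ : ℝ} (h0 : 0 ≤ p) (h1 : p ≤ 1) (hm : 0 < m)
    (hpm : N * p = m) (hτ : 0 < τ) (hq : Real.exp (-m) ≤ q)
    (hA : A ^ 2 * (8 + 16 * τ) ≤ m * τ ^ 2)
    (hconc : ∀ x ∈ sparseBall N s, cubeProb p {t | τ / 2 < |sampleDeviation V m x t|} ≤ 1 / 2)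
    (hsign : ∀ (J : Finset (Fin N)) (ρ : ℝ), 0 < ρ → J.card ≤ 6 * m →
      (∀ x ∈ sparseBall N s, ∑ i ∈ J, ‖V.mulVec x i‖ ^ 2 ≤ ρ ^ 2) →
      cubeProb (1 / 2) {t | ∃ x ∈ sparseBall N s, A * ρ < |signSum V J x t|} ≤ q) :
    cubeProb p {t | ∃ x ∈ sparseBall N s, τ < |sampleDeviation V m x t|} ≤
      4 * cubeProb p {t | ∃ x ∈ sparseBall N s, 2 * τ < |sampleDeviation V m x t|} + 6 * q := by
  set G := {t | ∃ x ∈ sparseBall N s, 2 * τ < |sampleDeviation V m x t|} with hG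
  set C := {t : Fin N → Fin 2 | 3 * m < ((Finset.univ.filter fun i => t i = 1).card : ℝ)} with hC
  have hq0 : 0 ≤ q := (Real.exp_pos _).le.trans hq
  have hCq : cubeProb p C ≤ q :=
    (cubeProb_card_gt_le h0 h1 (by rw [Fintype.card_fin, hpm])).trans hq
  -- If both deviations are at most 2τ, each sampled energy is at most m(1 + 2τ), and the energy
  -- where the samples differ is at most their sum.
  set ρ : ℝ := Real.sqrt (m * (2 + 4 * τ)) with hρ
  have hρ0 : 0 < ρ := Real.sqrt_pos.2 (by positivity)
  have hρ2 : ρ ^ 2 = m * (2 + 4 * τ) := Real.sq_sqrt (by positivity)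
  have hAρ : A * ρ ≤ m * (τ / 2) := by
    refine le_of_sq_le_sq ?_ (by positivity)
    calc (A * ρ) ^ 2 = m / 4 * (A ^ 2 * (8 + 16 * τ)) := by rw [mul_pow, hρ2]; ring
      _ ≤ m / 4 * (m * τ ^ 2) := mul_le_mul_of_nonneg_left hA (by positivity)
      _ = (m * (τ / 2)) ^ 2 := by ring
  set E := {z : (Fin N → Fin 2) × (Fin N → Fin 2) | (∃ x ∈ sparseBall N s,
        τ / 2 < |sampleDeviation V m x z.1 - sampleDeviation V m x z.2|) ∧
      ((Finset.univ.filter fun i => z.1 i ≠ z.2 i).card : ℝ) ≤ 6 * m ∧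
      ∀ x ∈ sparseBall N s, ∑ i with z.1 i ≠ z.2 i, ‖V.mulVec x i‖ ^ 2 ≤ ρ ^ 2} with hE
  have hEq : pairProb p E ≤ q := pairProb_symmetrized_le h0 h1 hm hq0 hAρ
    fun J hJ hJx => hsign J ρ hρ0 hJ hJx
  have hfirst : cubeProb p {t | ∃ x ∈ sparseBall N s, τ < |sampleDeviation V m x t|} ≤
      2 * pairProb p {z | ∃ x ∈ sparseBall N s,
        τ / 2 < |sampleDeviation V m x z.1 - sampleDeviation V m x z.2|} := by
    -- The witness x depends on t only, so pointwise concentration suffices: an independent copy has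
    -- deviation at most τ/2 at this x with probability at least 1/2.
    refine cubeProb_le_two_mul_pairProb h0 h1 ?_
    rintro t ⟨x, hx, ht⟩
    have hc := cubeProb_compl p {t | τ / 2 < |sampleDeviation V m x t|}
    have hle := hconc x hx
    refine le_trans (by rw [hc]; linarith : 1 / 2 ≤ cubeProb p _) (cubeProb_mono h0 h1 ?_)
    intro t' ht'
    have ht'' : |sampleDeviation V m x t'| ≤ τ / 2 := not_lt.1 ht'
    refine ⟨x, hx, ?_⟩
    have := abs_sub_abs_le_abs_sub (sampleDeviation V m x t) (sampleDeviation V m x t')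
    simp only
    linarith
  have hsub : {z | ∃ x ∈ sparseBall N s,
      τ / 2 < |sampleDeviation V m x z.1 - sampleDeviation V m x z.2|} ⊆
      (({z | z.1 ∈ G} ∪ {z | z.2 ∈ G}) ∪ ({z | z.1 ∈ C} ∪ {z | z.2 ∈ C})) ∪ E := by
    intro z hz
    by_cases hG1 : z.1 ∈ G
    · exact Or.inl (Or.inl (Or.inl hG1))
    by_cases hG2 : z.2 ∈ G
    · exact Or.inl (Or.inl (Or.inr hG2))
    by_cases hC1 : z.1 ∈ C
    · exact Or.inl (Or.inr (Or.inl hC1))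
    by_cases hC2 : z.2 ∈ C
    · exact Or.inl (Or.inr (Or.inr hC2))
    refine Or.inr ⟨hz, ?_, fun x hx => ?_⟩
    · have hsubset : (Finset.univ.filter fun i => z.1 i ≠ z.2 i) ⊆
          (Finset.univ.filter fun i => z.1 i = 1) ∪ (Finset.univ.filter fun i => z.2 i = 1) := by
        intro i
        simp only [Finset.mem_filter, Finset.mem_univ, true_and, Finset.mem_union]
        have h01 : ∀ a : Fin 2, a = 0 ∨ a = 1 := by decide
        rcases h01 (z.1 i) with h1 | h1 <;> rcases h01 (z.2 i) with h2 | h2 <;> simp [h1, h2]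
      have hcard := (Finset.card_le_card hsubset).trans (Finset.card_union_le _ _)
      have hcard' : ((Finset.univ.filter fun i => z.1 i ≠ z.2 i).card : ℝ) ≤
          (Finset.univ.filter fun i => z.1 i = 1).card +
            (Finset.univ.filter fun i => z.2 i = 1).card := by exact_mod_cast hcard
      have e1 : ((Finset.univ.filter fun i => z.1 i = 1).card : ℝ) ≤ 3 * m := by
        by_contra! h; exact hC1 h
      have e2 : ((Finset.univ.filter fun i => z.2 i = 1).card : ℝ) ≤ 3 * m := by
        by_contra! h; exact hC2 h
      linarith
    · have e1 : |sampleDeviation V m x z.1| ≤ 2 * τ := by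
        by_contra! h; exact hG1 ⟨x, hx, h⟩
      have e2 : |sampleDeviation V m x z.2| ≤ 2 * τ := by
        by_contra! h; exact hG2 ⟨x, hx, h⟩
      have e3 := sum_mulVec_le_of_sampleDeviation_le hm hx.2 e1
      have e4 := sum_mulVec_le_of_sampleDeviation_le hm hx.2 e2
      have e5 : ∑ i with z.1 i ≠ z.2 i, ‖V.mulVec x i‖ ^ 2 ≤
          ∑ i, (if z.1 i = 1 then ‖V.mulVec x i‖ ^ 2 else 0) +
            ∑ i, (if z.2 i = 1 then ‖V.mulVec x i‖ ^ 2 else 0) := by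
        rw [Finset.sum_filter, ← Finset.sum_add_distrib]
        refine Finset.sum_le_sum fun i _ => ?_
        have hf : 0 ≤ ‖V.mulVec x i‖ ^ 2 := by positivity
        have h01 : ∀ a : Fin 2, a = 0 ∨ a = 1 := by decide
        rcases h01 (z.1 i) with h1 | h1 <;> rcases h01 (z.2 i) with h2 | h2 <;> simp [h1, h2, hf]
      rw [hρ2]
      linarith
  have hsecond := pairProb_mono h0 h1 hsub
  have u1 := pairProb_union_le h0 h1
    (({z | z.1 ∈ G} ∪ {z | z.2 ∈ G}) ∪ ({z | z.1 ∈ C} ∪ {z | z.2 ∈ C})) E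
  have u2 := pairProb_union_le h0 h1
    ({z | z.1 ∈ G} ∪ {z : (Fin N → Fin 2) × (Fin N → Fin 2) | z.2 ∈ G})
    ({z | z.1 ∈ C} ∪ {z | z.2 ∈ C})
  have u3 := pairProb_union_le h0 h1 {z : (Fin N → Fin 2) × (Fin N → Fin 2) | z.1 ∈ G}
    {z | z.2 ∈ G}
  have u4 := pairProb_union_le h0 h1 {z : (Fin N → Fin 2) × (Fin N → Fin 2) | z.1 ∈ C}
    {z | z.2 ∈ C}
  rw [pairProb_fst, pairProb_snd] at u3 u4
  linarith

/-- The deviation never exceeds the dimension. -/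
theorem abs_sampleDeviation_le (hm : 1 ≤ m) (hN : 1 ≤ N)
    (hV : ∀ x : Fin N → ℂ, ∑ i, ‖V.mulVec x i‖ ^ 2 = N * ∑ j, ‖x j‖ ^ 2) {x : Fin N → ℂ}
    (hx : x ∈ sparseBall N s) (t : Fin N → Fin 2) : |sampleDeviation V m x t| ≤ N := by
  have hN' : (1 : ℝ) ≤ N := by exact_mod_cast hN
  have hx0 : 0 ≤ ∑ j, ‖x j‖ ^ 2 := Finset.sum_nonneg fun _ _ => by positivity
  have hx1 := hx.2
  have e0 : 0 ≤ ∑ i, (if t i = 1 then ‖V.mulVec x i‖ ^ 2 else 0) :=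
    Finset.sum_nonneg fun _ _ => by split_ifs <;> positivity
  have e1 : ∑ i, (if t i = 1 then ‖V.mulVec x i‖ ^ 2 else 0) ≤ N := by
    calc _ ≤ ∑ i, ‖V.mulVec x i‖ ^ 2 :=
          Finset.sum_le_sum fun _ _ => by split_ifs <;> [exact le_rfl; positivity]
      _ = N * ∑ j, ‖x j‖ ^ 2 := hV x
      _ ≤ N := mul_le_of_le_one_right (by linarith) hx1
  have e2 : m⁻¹ * ∑ i, (if t i = 1 then ‖V.mulVec x i‖ ^ 2 else 0) ≤ N :=
    (mul_le_of_le_one_left e0 (inv_le_one_of_one_le₀ hm)).trans e1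
  have e3 : 0 ≤ m⁻¹ * ∑ i, (if t i = 1 then ‖V.mulVec x i‖ ^ 2 else 0) :=
    mul_nonneg (inv_nonneg.2 (by linarith)) e0
  rw [sampleDeviation, abs_le]
  constructor <;> linarith

/-- Iterating the doubling inequality until the deviation exceeds its maximal value. -/
theorem cubeProb_sup_sampleDeviation_le {p τ₀ : ℝ} (h0 : 0 ≤ p) (h1 : p ≤ 1) (hm : 1 ≤ m)
    (hN : 1 ≤ N) (hpm : N * p = m)
    (hV : ∀ x : Fin N → ℂ, ∑ i, ‖V.mulVec x i‖ ^ 2 = N * ∑ j, ‖x j‖ ^ 2)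
    (hτ₀ : 0 < τ₀) (hq : Real.exp (-m) ≤ q)
    (hA : A ^ 2 * (8 + 16 * τ₀) ≤ m * τ₀ ^ 2)
    (hconc : ∀ x ∈ sparseBall N s, cubeProb p {t | τ₀ / 2 < |sampleDeviation V m x t|} ≤ 1 / 2)
    (hsign : ∀ (J : Finset (Fin N)) (ρ : ℝ), 0 < ρ → J.card ≤ 6 * m →
      (∀ x ∈ sparseBall N s, ∑ i ∈ J, ‖V.mulVec x i‖ ^ 2 ≤ ρ ^ 2) →
      cubeProb (1 / 2) {t | ∃ x ∈ sparseBall N s, A * ρ < |signSum V J x t|} ≤ q) (k : ℕ) :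
    ∀ τ, τ₀ ≤ τ → N ≤ 2 ^ k * τ →
      cubeProb p {t | ∃ x ∈ sparseBall N s, τ < |sampleDeviation V m x t|} ≤
        2 * (4 ^ k - 1) * q := by
  induction k with
  | zero =>
    intro τ _ hNτ
    rw [pow_zero, one_mul] at hNτ
    simp only [pow_zero, sub_self, mul_zero, zero_mul]
    refine le_of_eq ((congrArg (cubeProb _) ?_).trans (cubeProb_empty _))
    ext t
    simp only [Set.mem_ofPred_eq, Set.mem_empty_iff_false, iff_false]
    rintro ⟨x, hx, h⟩
    have := abs_sampleDeviation_le hm hN hV hx t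
    linarith
  | succ k ih =>
    intro τ hτ hNτ
    have hτ0 : 0 < τ := hτ₀.trans_le hτ
    have hAτ : A ^ 2 * (8 + 16 * τ) ≤ m * τ ^ 2 := by
      -- (8 + 16τ)/τ² decreases in τ, so the smallness condition passes from τ₀ to every larger τ.
      have e1 : τ₀ ^ 2 * (8 + 16 * τ) ≤ τ ^ 2 * (8 + 16 * τ₀) := by
        have : τ ^ 2 * (8 + 16 * τ₀) - τ₀ ^ 2 * (8 + 16 * τ) =
            (τ - τ₀) * (8 * (τ + τ₀) + 16 * (τ * τ₀)) := by ring
        have : 0 ≤ (τ - τ₀) * (8 * (τ + τ₀) + 16 * (τ * τ₀)) :=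
          mul_nonneg (by linarith) (by positivity)
        linarith
      refine le_of_mul_le_mul_left ?_ (by positivity : 0 < τ₀ ^ 2)
      calc τ₀ ^ 2 * (A ^ 2 * (8 + 16 * τ)) = A ^ 2 * (τ₀ ^ 2 * (8 + 16 * τ)) := by ring
        _ ≤ A ^ 2 * (τ ^ 2 * (8 + 16 * τ₀)) := mul_le_mul_of_nonneg_left e1 (sq_nonneg A)
        _ = τ ^ 2 * (A ^ 2 * (8 + 16 * τ₀)) := by ring
        _ ≤ τ ^ 2 * (m * τ₀ ^ 2) := mul_le_mul_of_nonneg_left hA (by positivity)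
        _ = τ₀ ^ 2 * (m * τ ^ 2) := by ring
    have hstep := cubeProb_sup_sampleDeviation_doubling (V := V) (s := s) h0 h1 (by linarith) hpm
      hτ0 hq hAτ (fun x hx => (cubeProb_mono h0 h1 fun t ht => by
        have : τ / 2 < |sampleDeviation V m x t| := ht
        simp only [Set.mem_ofPred_eq]
        linarith).trans (hconc x hx)) hsign
    -- The coefficient 2(4^k − 1) solves a_{k+1} = 4a_k + 6 with a_0 = 0.
    have hih := ih (2 * τ) (by linarith) (by rw [pow_succ] at hNτ; linarith)
    rw [pow_succ]
    linarith

end Symmetrization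

/-! ### From selectors to the discrete cube, and the restricted isometry constant -/

/-- Independence gives the mass of each point of the cube, and subadditivity over the finitely many
points gives the upper bound. -/
theorem measure_selectors_mem_le {ι Ω : Type*} [Fintype ι] [DecidableEq ι] [MeasurableSpace Ω]
    {μ : MeasureTheory.Measure Ω} [MeasureTheory.IsProbabilityMeasure μ] {θ : ι → Ω → Fin 2}
    {p : ℝ} (h0 : 0 ≤ p) (h1 : p ≤ 1) (hθ : ∀ i, Measurable (θ i))
    (hind : ProbabilityTheory.iIndepFun θ μ)
    (hp : ∀ i, μ {ω | θ i ω = 1} = ENNReal.ofReal p) (A : Set (ι → Fin 2)) :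
    μ {ω | (fun i => θ i ω) ∈ A} ≤ ENNReal.ofReal (cubeProb p A) := by
  classical
  have hsingle : ∀ i a, μ (θ i ⁻¹' {a}) = ENNReal.ofReal (if a = 1 then p else 1 - p) := by
    intro i a
    by_cases ha : a = 1
    · subst ha
      rw [if_pos rfl, ← hp i]
      rfl
    · have hcompl : θ i ⁻¹' {a} = (θ i ⁻¹' {1})ᶜ := by
        ext ω
        have h01 : ∀ a b : Fin 2, a ≠ 1 → (b = a ↔ b ≠ 1) := by decide
        exact h01 a (θ i ω) ha
      rw [if_neg ha, hcompl, MeasureTheory.prob_compl_eq_one_sub (hθ i (measurableSet_singleton 1)),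
        ENNReal.ofReal_sub _ h0, ENNReal.ofReal_one, ← hp i]
      rfl
  have hpoint : ∀ t : ι → Fin 2, μ {ω | (fun i => θ i ω) = t} = ENNReal.ofReal (cubeWeight p t) := by
    intro t
    have h := hind.measure_inter_preimage_eq_mul Finset.univ (sets := fun i => {t i})
      (fun i _ => measurableSet_singleton _)
    have hset : {ω | (fun i => θ i ω) = t} = ⋂ i ∈ Finset.univ, θ i ⁻¹' {t i} := by
      ext ω
      simp [funext_iff]
    rw [hset, h, cubeWeight, ENNReal.ofReal_prod_of_nonneg]
    · exact Finset.prod_congr rfl fun i _ => hsingle i (t i)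
    · intro i _
      split_ifs <;> linarith
  have hset : {ω | (fun i => θ i ω) ∈ A} =
      ⋃ t ∈ (Finset.univ.filter fun t => t ∈ A), {ω | (fun i => θ i ω) = t} := by
    ext ω
    simp
  rw [hset]
  refine (MeasureTheory.measure_biUnion_finset_le _ _).trans (le_of_eq ?_)
  simp only [hpoint]
  rw [← ENNReal.ofReal_sum_of_nonneg fun t _ => cubeWeight_nonneg h0 h1 t, Finset.sum_filter]
  rfl

theorem sum_norm_sq_mulVec_of_mem_unitaryGroup {N : ℕ} {U : Matrix (Fin N) (Fin N) ℂ}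
    (hU : U ∈ Matrix.unitaryGroup (Fin N) ℂ) (x : Fin N → ℂ) :
    ∑ i, ‖U.mulVec x i‖ ^ 2 = ∑ j, ‖x j‖ ^ 2 := by
  have hdot : ∀ y : Fin N → ℂ, star y ⬝ᵥ y = ((∑ i, ‖y i‖ ^ 2 : ℝ) : ℂ) := fun y => by
    simp only [dotProduct, Pi.star_apply]
    push_cast
    refine Finset.sum_congr rfl fun i _ => ?_
    rw [← Complex.conj_mul' (y i)]
    rfl
  have h : star (U.mulVec x) ⬝ᵥ U.mulVec x = star x ⬝ᵥ x := by
    rw [Matrix.star_mulVec, ← Matrix.dotProduct_mulVec, Matrix.mulVec_mulVec,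
      ← Matrix.star_eq_conjTranspose, Matrix.mem_unitaryGroup_iff'.1 hU, Matrix.one_mulVec]
  rw [hdot, hdot] at h
  exact_mod_cast h

/-! ### Isometry constants in terms of sampled energies -/

section Isometry

variable {N s : ℕ} {U : Matrix (Fin N) (Fin N) ℂ} {m δ : ℝ}

theorem norm_sqrt_smul_mulVec_sq (x : Fin N → ℂ) (i : Fin N) :
    ‖(((Real.sqrt N : ℝ) : ℂ) • U).mulVec x i‖ ^ 2 = N * ‖U.mulVec x i‖ ^ 2 := by
  rw [Matrix.smul_mulVec, Pi.smul_apply, smul_eq_mul, norm_mul, Complex.norm_real,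
    Real.norm_of_nonneg (Real.sqrt_nonneg _), mul_pow, Real.sq_sqrt (Nat.cast_nonneg N)]

theorem norm_subsampledMatrix_mulVec_sq (hm : 0 < m) (t : Fin N → Fin 2)
    (x : EuclideanSpace ℂ (Fin N)) :
    ‖WithLp.toLp 2 ((subsampledMatrix U m (selectedIndices t)).mulVec x.ofLp)‖ ^ 2 =
      sampleDeviation (((Real.sqrt N : ℝ) : ℂ) • U) m x.ofLp t + ‖x‖ ^ 2 := by
  rw [EuclideanSpace.norm_sq_eq, EuclideanSpace.norm_sq_eq, sampleDeviation, sub_add_cancel]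
  have hterm : ∀ i : selectedIndices t,
      ‖(subsampledMatrix U m (selectedIndices t)).mulVec x.ofLp i‖ ^ 2 =
        m⁻¹ * ‖(((Real.sqrt N : ℝ) : ℂ) • U).mulVec x.ofLp i‖ ^ 2 := fun i => by
    rw [norm_sqrt_smul_mulVec_sq, subsampledMatrix, Matrix.smul_mulVec, Pi.smul_apply, smul_eq_mul,
      norm_mul, Complex.norm_real, Real.norm_of_nonneg (Real.sqrt_nonneg _), mul_pow,
      Real.sq_sqrt (by positivity)]
    have : (U.submatrix (fun i : selectedIndices t => (i : Fin N)) id).mulVec x.ofLp i =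
        U.mulVec x.ofLp i := rfl
    rw [this]
    ring
  simp only [hterm]
  rw [← Finset.mul_sum, Finset.sum_coe_sort (selectedIndices t)
    fun i => ‖(((Real.sqrt N : ℝ) : ℂ) • U).mulVec x.ofLp i‖ ^ 2, selectedIndices,
    Finset.sum_filter]

theorem sampleDeviation_smul (V : Matrix (Fin N) (Fin N) ℂ) (c : ℝ) (x : Fin N → ℂ)
    (t : Fin N → Fin 2) :
    sampleDeviation V m ((c : ℂ) • x) t = c ^ 2 * sampleDeviation V m x t := by
  have h1 : ∀ i, (if t i = 1 then ‖V.mulVec ((c : ℂ) • x) i‖ ^ 2 else 0) =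
      c ^ 2 * (if t i = 1 then ‖V.mulVec x i‖ ^ 2 else 0) := fun i => by
    rw [Matrix.mulVec_smul, Pi.smul_apply, norm_smul, Complex.norm_real, mul_pow, Real.norm_eq_abs,
      sq_abs, mul_ite, mul_zero]
  have h2 : ∀ j, ‖((c : ℂ) • x) j‖ ^ 2 = c ^ 2 * ‖x j‖ ^ 2 := fun j => by
    rw [Pi.smul_apply, norm_smul, Complex.norm_real, mul_pow, Real.norm_eq_abs, sq_abs]
  simp only [sampleDeviation, h1, h2, ← Finset.mul_sum]
  ring

/-- A large restricted isometry constant is witnessed by a large deviation on the sparse ball. -/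
theorem exists_lt_abs_sampleDeviation (hm : 0 < m) (hδ : 0 < δ) (t : Fin N → Fin 2)
    (h : δ ≤ restrictedIsometryConstant s (subsampledMatrix U m (selectedIndices t))) :
    ∃ x ∈ sparseBall N s, δ / 2 < |sampleDeviation (((Real.sqrt N : ℝ) : ℂ) • U) m x t| := by
  by_contra! hcon
  -- Halving δ leaves room for strictness: if no deviation exceeds δ/2, the constant is at most δ/2
  -- < δ.
  have hmem : δ / 2 ∈ ripConstants s (subsampledMatrix U m (selectedIndices t)) := by
    refine ⟨by linarith, fun x hx => ?_⟩
    rw [norm_subsampledMatrix_mulVec_sq hm]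
    suffices hs : |sampleDeviation (((Real.sqrt N : ℝ) : ℂ) • U) m x.ofLp t| ≤
        δ / 2 * ‖x‖ ^ 2 by
      have := abs_le.1 hs
      constructor <;> linarith
    by_cases hx0 : x = 0
    · subst hx0
      simp [sampleDeviation]
    · have hnx : 0 < ‖x‖ := norm_pos_iff.2 hx0
      have hball : ((‖x‖⁻¹ : ℝ) : ℂ) • x.ofLp ∈ sparseBall N s := by
        constructor
        · refine le_trans (Finset.card_le_card fun i => ?_) hx
          simp only [Finset.mem_filter, Finset.mem_univ, true_and, Pi.smul_apply]
          exact fun hne h0 => hne (by rw [h0, smul_zero])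
        · have e : ∀ j, ‖(((‖x‖⁻¹ : ℝ) : ℂ) • x.ofLp) j‖ ^ 2 = ‖x‖⁻¹ ^ 2 * ‖x j‖ ^ 2 := fun j => by
            rw [Pi.smul_apply, norm_smul, Complex.norm_real, mul_pow, Real.norm_eq_abs, sq_abs]
          simp only [e]
          rw [← Finset.mul_sum, ← EuclideanSpace.norm_sq_eq, ← mul_pow,
            inv_mul_cancel₀ hnx.ne', one_pow]
      have hb := hcon _ hball
      rw [sampleDeviation_smul, abs_mul, abs_of_nonneg (by positivity), inv_pow,
        inv_mul_eq_div, div_le_iff₀ (by positivity)] at hb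
      exact hb
  have := csInf_le (⟨0, fun d hd => hd.1⟩ : BddBelow (ripConstants s _)) hmem
  rw [restrictedIsometryConstant] at h
  linarith

end Isometry

/-- Concentration of the sampled energy of a single sparse vector. -/
theorem cubeProb_sampleDeviation_le {N s : ℕ} {V : Matrix (Fin N) (Fin N) ℂ} {K m p u : ℝ}
    (hK : 0 < K) (hs : 0 < s) (hVK : ∀ i j, ‖V i j‖ ≤ K) (hN : 1 ≤ N)
    (hV : ∀ x : Fin N → ℂ, ∑ i, ‖V.mulVec x i‖ ^ 2 = N * ∑ j, ‖x j‖ ^ 2) (h0 : 0 < p) (h1 : p ≤ 1)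
    (hpm : N * p = m) (hu : 0 < u) (hu2 : u ≤ 2) (hmu : 8 * (s * K ^ 2) ≤ m * u ^ 2)
    {x : Fin N → ℂ} (hx : x ∈ sparseBall N s) :
    cubeProb p {t | u < |sampleDeviation V m x t|} ≤ 1 / 2 := by
  have hN0 : (0 : ℝ) < N := by exact_mod_cast hN
  have hs0 : (0 : ℝ) < s := by exact_mod_cast hs
  have hm : 0 < m := by rw [← hpm]; positivity
  set v : ℝ := s * K ^ 2 / m with hv
  have hv0 : 0 < v := by positivity
  have hsup : ∀ i, ‖V.mulVec x i‖ ^ 2 ≤ s * K ^ 2 := fun i => by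
    have e1 := (norm_mulVec_le hVK x i).trans
      (mul_le_mul_of_nonneg_left (sum_norm_le_of_mem_sparseBall hx) hK.le)
    have e2 := pow_le_pow_left₀ (norm_nonneg _) e1 2
    rw [mul_pow, Real.sq_sqrt hs0.le] at e2
    linarith
  -- l = u/(2v) minimizes l²v − lu, and u ≤ 2 is what makes it admissible in the Bernstein bound.
  have key := cubeProb_bernoulli_le (p := p) h0 h1 (fun i => ‖V.mulVec x i‖ ^ 2 / N)
    (l := u / (2 * v)) (u := u) (v := v) (by positivity) (fun i => by positivity)
    (fun i => by
      calc u / (2 * v) * (‖V.mulVec x i‖ ^ 2 / N) ≤ u / (2 * v) * (s * K ^ 2 / N) := by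
            have := hsup i
            gcongr
        _ = u / 2 * p := by rw [hv, ← hpm]; field_simp
        _ ≤ p := by nlinarith)
    (by
      calc ∑ i, (‖V.mulVec x i‖ ^ 2 / N) ^ 2
          ≤ ∑ i, s * K ^ 2 / N ^ 2 * ‖V.mulVec x i‖ ^ 2 := by
            refine Finset.sum_le_sum fun i _ => ?_
            have := mul_le_mul_of_nonneg_right (hsup i)
              (by positivity : 0 ≤ ‖V.mulVec x i‖ ^ 2 / (N : ℝ) ^ 2)
            calc (‖V.mulVec x i‖ ^ 2 / N) ^ 2
                = ‖V.mulVec x i‖ ^ 2 * (‖V.mulVec x i‖ ^ 2 / (N : ℝ) ^ 2) := by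
                  field_simp
              _ ≤ s * K ^ 2 * (‖V.mulVec x i‖ ^ 2 / (N : ℝ) ^ 2) := this
              _ = s * K ^ 2 / N ^ 2 * ‖V.mulVec x i‖ ^ 2 := by ring
        _ = s * K ^ 2 / N * ∑ j, ‖x j‖ ^ 2 := by
            rw [← Finset.mul_sum, hV]; field_simp
        _ ≤ s * K ^ 2 / N * 1 := mul_le_mul_of_nonneg_left hx.2 (by positivity)
        _ = p * v := by rw [hv, ← hpm]; field_simp)
  have hdev : ∀ t : Fin N → Fin 2, sampleDeviation V m x t =
      ∑ i, ((if t i = 1 then p⁻¹ else 0) - 1) * (‖V.mulVec x i‖ ^ 2 / N) := fun t => by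
    have ha : ∀ i, (if t i = 1 then p⁻¹ else 0) * (‖V.mulVec x i‖ ^ 2 / N) =
        m⁻¹ * (if t i = 1 then ‖V.mulVec x i‖ ^ 2 else 0) := fun i => by
      split_ifs
      · rw [← hpm]; field_simp
      · simp
    have hb : ∑ i, ‖V.mulVec x i‖ ^ 2 / N = ∑ j, ‖x j‖ ^ 2 := by
      rw [← Finset.sum_div, hV]; field_simp
    simp only [sub_mul, one_mul, Finset.sum_sub_distrib, ha, hb, ← Finset.mul_sum]
    rfl
  simp only [hdev]
  refine key.trans ?_
  have e1 : (u / (2 * v)) ^ 2 * v - u / (2 * v) * u = -(m * u ^ 2 / (4 * (s * K ^ 2))) := by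
    rw [hv]; field_simp; ring
  have e2 : 2 ≤ m * u ^ 2 / (4 * (s * K ^ 2)) := by
    rw [le_div_iff₀ (by positivity)]; linarith
  have e3 : Real.exp (-(m * u ^ 2 / (4 * (s * K ^ 2)))) ≤ Real.exp (-2) :=
    Real.exp_le_exp.2 (by linarith)
  have e4 : Real.exp (-2) ≤ 1 / 4 := by
    rw [Real.exp_neg, inv_le_comm₀ (Real.exp_pos _) (by norm_num)]
    have h2 : Real.exp 2 = Real.exp 1 * Real.exp 1 := by rw [← Real.exp_add]; norm_num
    have := Real.exp_one_gt_d9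
    rw [h2]
    nlinarith
  rw [e1]
  linarith

/-! ### The main estimate -/

theorem clog_two_le_three_mul_log {s : ℕ} (hs : 2 ≤ s) : (Nat.clog 2 s : ℝ) ≤ 3 * Real.log s := by
  have hl2 := Real.log_two_gt_d9
  have hs' : (2 : ℝ) ≤ s := by exact_mod_cast hs
  have hls : Real.log 2 ≤ Real.log s := Real.log_le_log (by norm_num) hs'
  have hpos : 0 < Nat.clog 2 s := Nat.clog_pos (by norm_num) hs
  have hlt : 2 ^ (Nat.clog 2 s - 1) < s := Nat.pow_pred_clog_lt_self (by norm_num) (by omega)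
  have hlt' : (2 : ℝ) ^ (Nat.clog 2 s - 1) ≤ s := by exact_mod_cast hlt.le
  have hlog := Real.log_le_log (by positivity) hlt'
  rw [Real.log_pow, Nat.cast_sub hpos, Nat.cast_one] at hlog
  nlinarith

theorem add_four_sq_le (w x y z : ℝ) :
    (w + x + y + z) ^ 2 ≤ 4 * (w ^ 2 + x ^ 2 + y ^ 2 + z ^ 2) := by
  have h : 4 * (w ^ 2 + x ^ 2 + y ^ 2 + z ^ 2) - (w + x + y + z) ^ 2 = (w - x) ^ 2 + (w - y) ^ 2 +
      (w - z) ^ 2 + (x - y) ^ 2 + (x - z) ^ 2 + (y - z) ^ 2 := by ring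
  have : 0 ≤ (w - x) ^ 2 + (w - y) ^ 2 + (w - z) ^ 2 + (x - y) ^ 2 + (x - z) ^ 2 + (y - z) ^ 2 := by
    positivity
  linarith

/-- The constant produced by the chaining argument, in terms of the logarithmic factors. -/
theorem chaining_constant_sq_le {s k : ℕ} {K a b c l H β E : ℝ} (hs : 2 ≤ s) (hK : 1 ≤ K)
    (hc : 0 ≤ c) (hl : 0 ≤ l) (hlb : l ≤ 6 * b) (hka : k ≤ 3 * a)
    (hcP : c ≤ 4 * (a ^ 2 * b * c)) (hP8 : 1 ≤ 8 * (a ^ 2 * b * c))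
    (hH2 : H ^ 2 = 4100 * (s * K ^ 2 * l * c)) (hβ2 : β ^ 2 = 11 * c + E) :
    (6 * k * H + 9 * Real.sqrt s * K * β + 10 * K * Real.sqrt c + 2 * K) ^ 2 ≤
      s * K ^ 2 * (4 * (7974396 * (a ^ 2 * b * c) + 81 * E)) := by
  have hs' : (2 : ℝ) ≤ s := by exact_mod_cast hs
  have hK0 : 0 < K := by linarith
  have hKs : K ^ 2 ≤ s * K ^ 2 := le_mul_of_one_le_left (by positivity) (by linarith)
  have hS0 : 0 ≤ s * K ^ 2 := by positivity
  set P := a ^ 2 * b * c with hPdef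
  refine (add_four_sq_le _ _ _ _).trans ?_
  have e1 : (6 * k * H) ^ 2 ≤ 7970400 * (s * K ^ 2 * P) := by
    have hk2 : (k : ℝ) ^ 2 ≤ (3 * a) ^ 2 := pow_le_pow_left₀ (Nat.cast_nonneg k) hka 2
    calc (6 * k * H) ^ 2 = 36 * k ^ 2 * (4100 * (s * K ^ 2 * l * c)) := by rw [← hH2]; ring
      _ ≤ 36 * (3 * a) ^ 2 * (4100 * (s * K ^ 2 * (6 * b) * c)) := by gcongr
      _ = 7970400 * (s * K ^ 2 * P) := by rw [hPdef]; ring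
  have e2 : (9 * Real.sqrt s * K * β) ^ 2 ≤ s * K ^ 2 * (3564 * P + 81 * E) := by
    calc (9 * Real.sqrt s * K * β) ^ 2 = 81 * (Real.sqrt s) ^ 2 * K ^ 2 * β ^ 2 := by ring
      _ = s * K ^ 2 * (891 * c + 81 * E) := by
          rw [Real.sq_sqrt (by linarith), hβ2]; ring
      _ ≤ s * K ^ 2 * (3564 * P + 81 * E) :=
          mul_le_mul_of_nonneg_left (by linarith) (by linarith)
  have e3 : (10 * K * Real.sqrt c) ^ 2 ≤ 400 * (s * K ^ 2 * P) := by
    have h3 : K ^ 2 * c ≤ s * K ^ 2 * (4 * P) :=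
      mul_le_mul hKs hcP (by linarith) (by linarith)
    calc (10 * K * Real.sqrt c) ^ 2 = 100 * (K ^ 2 * (Real.sqrt c) ^ 2) := by ring
      _ = 100 * (K ^ 2 * c) := by rw [Real.sq_sqrt (by linarith)]
      _ ≤ 400 * (s * K ^ 2 * P) := by linarith
  have e4 : (2 * K) ^ 2 ≤ 32 * (s * K ^ 2 * P) := by
    have h4 : K ^ 2 * 1 ≤ s * K ^ 2 * (8 * P) :=
      mul_le_mul hKs hP8 (by norm_num) (by linarith)
    linarith
  linarith

/-- Combined tail bound in terms of the sampling size, for constants absorbing all numerical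
factors. -/
theorem cubeProb_sup_le_of_sample_size {N s : ℕ} {V : Matrix (Fin N) (Fin N) ℂ} {K m p δ η : ℝ}
    (hK : 1 ≤ K) (hs : 2 ≤ s) (hVK : ∀ i j, ‖V i j‖ ≤ K)
    (hV : ∀ x : Fin N → ℂ, ∑ i, ‖V.mulVec x i‖ ^ 2 = N * ∑ j, ‖x j‖ ^ 2)
    (hm2 : 2 ≤ m) (hmN : m ≤ N) (h0 : 0 < p) (h1 : p ≤ 1) (hpm : N * p = m)
    (hδ : 0 < δ) (hδ1 : δ < 1) (hη : 0 < η) (hη1 : η < 1)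
    (hP : s * K ^ 2 * (10 ^ 10 * (Real.log s ^ 2 * Real.log m * Real.log N)) ≤ m * δ ^ 2)
    (hE : s * K ^ 2 * (10 ^ 6 * Real.log η⁻¹) ≤ m * δ ^ 2) :
    cubeProb p {t | ∃ x ∈ sparseBall N s, δ / 2 < |sampleDeviation V m x t|} ≤ η := by
  have hl2 := Real.log_two_gt_d9
  have hs' : (2 : ℝ) ≤ s := by exact_mod_cast hs
  have hN2' : (2 : ℝ) ≤ N := hm2.trans hmN
  have hN2 : 2 ≤ N := by exact_mod_cast hN2'
  have hN0 : (0 : ℝ) < N := by linarith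
  have hm0 : 0 < m := by linarith
  have hls : Real.log 2 ≤ Real.log s := Real.log_le_log (by norm_num) hs'
  have hlm : Real.log 2 ≤ Real.log m := Real.log_le_log (by norm_num) hm2
  have hlN : Real.log 2 ≤ Real.log N := Real.log_le_log (by norm_num) hN2'
  set a := Real.log s with ha
  set b := Real.log m with hb
  set c := Real.log N with hc
  set P := a ^ 2 * b * c with hPdef
  set E := Real.log η⁻¹ with hEdef
  have hE0 : 0 ≤ E := Real.log_nonneg ((one_le_inv₀ hη).2 hη1.le)
  have hab : 1 / 4 ≤ a ^ 2 * b := by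
    have e1 : (0.69 : ℝ) ^ 2 ≤ a ^ 2 := pow_le_pow_left₀ (by norm_num) (by linarith) 2
    have e2 : (0.69 : ℝ) ≤ b := by linarith
    exact le_trans (by norm_num) (mul_le_mul e1 e2 (by norm_num) (sq_nonneg a))
  have hcP : c ≤ 4 * P := by
    have : 1 / 4 * c ≤ a ^ 2 * b * c := mul_le_mul_of_nonneg_right hab (by linarith)
    linarith
  have hP8 : 1 ≤ 8 * P := by linarith
  have hP0 : 0 < P := by linarith
  have hK2 : 1 ≤ K ^ 2 := one_le_pow₀ hK
  have hδ2 : δ ^ 2 ≤ 1 := pow_le_one₀ hδ.le hδ1.le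
  have hsK : (s : ℝ) ≤ s * K ^ 2 := le_mul_of_one_le_right (by linarith) hK2
  have hS : (1 : ℝ) ≤ s * K ^ 2 := by linarith
  have hPm : 10 ^ 10 * P ≤ m * δ ^ 2 :=
    (le_mul_of_one_le_left (by positivity) hS).trans hP
  have hEm : 10 ^ 6 * E ≤ m * δ ^ 2 := (le_mul_of_one_le_left (by positivity) hS).trans hE
  have hmδ : m * δ ^ 2 ≤ m := mul_le_of_le_one_right hm0.le hδ2
  have hSm : s * K ^ 2 * 10 ^ 9 ≤ m * δ ^ 2 :=
    (mul_le_mul_of_nonneg_left (by linarith) (by linarith)).trans hP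
  have hsN : s ≤ N := by
    have : (s : ℝ) ≤ N := by linarith
    exact_mod_cast this
  set k := Nat.clog 2 s with hk
  have hka : (k : ℝ) ≤ 3 * a := clog_two_le_three_mul_log hs
  have hsk : s ≤ 2 ^ k := Nat.le_pow_clog (by norm_num) s
  have hks : k ≤ N := (Nat.clog_le_of_le_pow (Nat.lt_two_pow_self.le)).trans hsN
  -- N⁸ absorbs the factor 2 · 4^(n+1) ≤ 32 N³ accumulated by the doublings.
  set q := η / (N : ℝ) ^ 8 with hq
  have hq0 : 0 < q := by positivity
  -- The differing set has at most 6m elements, so 4|J| ≤ 24m = exp l. This is the source of the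
  -- factor log m.
  set l := Real.log (24 * m) with hl
  have hl1 : 1 ≤ l := by
    rw [hl, Real.le_log_iff_exp_le (by positivity)]
    have := Real.exp_one_lt_d9
    linarith
  have hlb : l ≤ 6 * b := by
    have e : (6 : ℝ) * b = Real.log (m ^ 6) := by rw [Real.log_pow, hb]; norm_num
    rw [e, hl]
    refine Real.log_le_log (by positivity) ?_
    have e5 : (2 : ℝ) ^ 5 ≤ m ^ 5 := pow_le_pow_left₀ (by norm_num) hm2 5
    have e6 : m ^ 6 = m ^ 5 * m := by ring
    rw [e6]
    exact mul_le_mul_of_nonneg_right (by linarith) hm0.le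
  set H := Real.sqrt (4100 * (s * K ^ 2 * l * c)) with hH
  have hH2 : H ^ 2 = 4100 * (s * K ^ 2 * l * c) := by
    have : 0 ≤ l := by linarith
    have : 0 ≤ c := by linarith
    exact Real.sq_sqrt (by positivity)
  -- exp(β²) = N¹¹/η, so a share q/(k + 1) per link satisfies q exp(β²)/(k + 1) = N³/(k + 1) ≥ 2.
  set β := Real.sqrt (11 * c + E) with hβ
  have hβ2 : β ^ 2 = 11 * c + E := Real.sq_sqrt (by linarith)
  set A := 6 * k * H + 9 * Real.sqrt s * K * β + 10 * K * Real.sqrt c + 2 * K with hA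
  -- At τ₀ = δ/2 the doubling condition reads A²(8 + 8δ) ≤ mδ²/4, and δ < 1 reduces it to this. The
  -- constants 10¹⁰ and 10⁶ leave room for 64·4·7974396 and 64·4·81.
  have hA2 : 64 * A ^ 2 ≤ m * δ ^ 2 := by
    have h := chaining_constant_sq_le hs hK (by linarith) (by linarith) hlb hka hcP hP8 hH2 hβ2
    have e1 : s * K ^ 2 * (4 * (7974396 * P + 81 * E)) =
        4 * 7974396 * (s * K ^ 2 * P) + 4 * 81 * (s * K ^ 2 * E) := by ring
    rw [e1] at h
    have e2 : 0 ≤ m * δ ^ 2 := by positivity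
    linarith
  have hlogq : 8 * c + E ≤ m := by linarith
  have hexpm : Real.exp (-m) ≤ q := by
    have e1 : q = Real.exp (-(8 * c + E)) := by
      rw [hq, neg_add, Real.exp_add, hEdef, Real.log_inv, neg_neg, Real.exp_log hη, Real.exp_neg,
        hc, show (8 : ℝ) * Real.log N = Real.log ((N : ℝ) ^ 8) by rw [Real.log_pow]; norm_num,
        Real.exp_log (by positivity)]
      ring
    rw [e1]
    exact Real.exp_le_exp.2 (by linarith)
  have hsign : ∀ (J : Finset (Fin N)) (ρ : ℝ), 0 < ρ → J.card ≤ 6 * m →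
      (∀ x ∈ sparseBall N s, ∑ i ∈ J, ‖V.mulVec x i‖ ^ 2 ≤ ρ ^ 2) →
      cubeProb (1 / 2) {t | ∃ x ∈ sparseBall N s, A * ρ < |signSum V J x t|} ≤ q := by
    intro J ρ hρ hJ hJx
    have hk0 : (0 : ℝ) < k + 1 := by positivity
    have h := cubeProb_sup_signSum_le (V := V) (K := K) (H := H) (β := β) (q := q / (k + 1))
      (by linarith) hVK (by omega) hsN hN2 hρ hJx hl1 (by
        rw [hl, Real.exp_log (by positivity)]; linarith) (Real.sqrt_nonneg _) hH2.ge
      (Real.sqrt_nonneg _) (by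
        rw [hβ2, Real.exp_add, hEdef, Real.exp_log (by positivity),
          show (11 : ℝ) * c = Real.log ((N : ℝ) ^ 11) by rw [Real.log_pow, hc]; norm_num,
          Real.exp_log (by positivity)]
        have e1 : q / (k + 1) * ((N : ℝ) ^ 11 * η⁻¹) = (N : ℝ) ^ 3 / (k + 1) := by
          rw [hq]; field_simp
        rw [e1, le_div_iff₀ hk0]
        have e2 : (k : ℝ) ≤ N := by exact_mod_cast hks
        have e3 : (2 : ℝ) ^ 2 ≤ (N : ℝ) ^ 2 := pow_le_pow_left₀ (by norm_num) hN2' 2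
        have e4 : (N : ℝ) ^ 3 = (N : ℝ) ^ 2 * N := by ring
        have e5 := mul_le_mul_of_nonneg_right e3 hN0.le
        rw [e4]
        linarith) hsk
    refine h.trans (le_of_eq ?_)
    field_simp
  -- 2^n ≤ 2N/δ < 2^(n+1): after n + 1 doublings the threshold δ/2 exceeds N, while 4^n stays
  -- polynomial in N because Nδ² ≥ 1.
  obtain ⟨n, hn1, hn2⟩ := exists_nat_pow_near (x := 2 * N / δ) (y := 2)
    (by rw [le_div_iff₀ hδ]; linarith) (by norm_num)
  have hmain := cubeProb_sup_sampleDeviation_le (τ₀ := δ / 2) (k := n + 1) h0.le h1 (by linarith)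
    (by omega) hpm hV (by linarith) hexpm
    (by
      have e1 := mul_le_mul_of_nonneg_left hδ1.le (sq_nonneg A)
      clear_value A
      linarith)
    (fun x hx => cubeProb_sampleDeviation_le (by linarith) (by omega) hVK (by omega) hV h0 h1 hpm
      (by linarith) (by linarith) (by linarith) hx)
    hsign (δ / 2) le_rfl (by
      rw [div_lt_iff₀ hδ] at hn2
      linarith)
  refine hmain.trans ?_
  have hN32 : (32 : ℝ) ≤ (N : ℝ) ^ 5 := by
    have := pow_le_pow_left₀ (by norm_num) hN2' 5
    norm_num at this
    exact this
  have h4 : (4 : ℝ) ^ (n + 1) ≤ 16 * (N : ℝ) ^ 3 := by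
    have e1 : (4 : ℝ) ^ (n + 1) = 4 * (2 ^ n) ^ 2 := by
      rw [← pow_mul, mul_comm n 2, pow_mul, pow_succ]; norm_num; ring
    have e2 : ((2 : ℝ) ^ n) ^ 2 ≤ (2 * N / δ) ^ 2 := pow_le_pow_left₀ (by positivity) hn1 2
    have e3 : (2 * N / δ) ^ 2 ≤ 4 * (N : ℝ) ^ 3 := by
      rw [div_pow, div_le_iff₀ (by positivity)]
      have e4 : 1 ≤ N * δ ^ 2 := by
        have : m * δ ^ 2 ≤ N * δ ^ 2 := mul_le_mul_of_nonneg_right hmN (sq_nonneg δ)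
        linarith
      have e5 := mul_le_mul_of_nonneg_left e4 (by positivity : 0 ≤ 4 * (N : ℝ) ^ 2)
      linarith
    rw [e1]
    linarith
  calc 2 * ((4 : ℝ) ^ (n + 1) - 1) * q ≤ 2 * (16 * (N : ℝ) ^ 3) * q := by
        gcongr; linarith
    _ = 32 * (N : ℝ) ^ 3 * q := by ring
    _ ≤ (N : ℝ) ^ 5 * (N : ℝ) ^ 3 * q := by gcongr
    _ = η := by rw [hq]; field_simp

theorem theorem4p1 :
    ∃ d₁ d₂ : ℝ, 0 < d₁ ∧ 0 < d₂ ∧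
      ∀ (N : ℕ) (U : Matrix (Fin N) (Fin N) ℂ) (K : ℝ) (m : ℝ)
        (Ω : Type*) [MeasurableSpace Ω] (μ : MeasureTheory.Measure Ω)
        [MeasureTheory.IsProbabilityMeasure μ] (θ : Fin N → Ω → Fin 2),
        U ∈ Matrix.unitaryGroup (Fin N) ℂ →
        1 ≤ K →
        (∀ k l : Fin N, Real.sqrt N * ‖U k l‖ ≤ K) →
        2 ≤ m → m ≤ N →
        (∀ i, Measurable (θ i)) →
        ProbabilityTheory.iIndepFun θ μ →
        (∀ i, μ {ω | θ i ω = 1} = ENNReal.ofReal (m / N)) →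
        ∀ (s : ℕ) (δ η : ℝ), 2 ≤ s → 0 < δ → δ < 1 → 0 < η → η < 1 →
          m ≥ s * K ^ 2 * (δ ^ 2)⁻¹ *
            max (d₁ * (Real.log s) ^ 2 * Real.log m * Real.log N) (d₂ * Real.log η⁻¹) →
          μ {ω | δ ≤ restrictedIsometryConstant s
              (subsampledMatrix U m (selectedIndices fun i => θ i ω))} ≤ ENNReal.ofReal η := by

  refine ⟨10 ^ 10, 10 ^ 6, by norm_num, by norm_num, ?_⟩
  intro N U K m Ω _ μ _ θ hU hK hUK hm2 hmN hθ hind hp s δ η hs hδ hδ1 hη hη1 hm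
  have hm0 : 0 < m := by linarith
  have hN0 : (0 : ℝ) < N := by linarith
  have h0 : 0 < m / N := by positivity
  have h1 : m / N ≤ 1 := (div_le_one hN0).2 hmN
  have hsK : 0 ≤ s * K ^ 2 * (δ ^ 2)⁻¹ := by positivity
  have hsize : ∀ {y : ℝ}, y ≤ max (10 ^ 10 * (Real.log s) ^ 2 * Real.log m * Real.log N)
      (10 ^ 6 * Real.log η⁻¹) → s * K ^ 2 * y ≤ m * δ ^ 2 := fun {y} hy => by
    have h := (mul_le_mul_of_nonneg_left hy hsK).trans hm
    rw [mul_right_comm, ← div_eq_mul_inv, div_le_iff₀ (by positivity)] at h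
    exact h
  refine (MeasureTheory.measure_mono fun ω hω => ?_).trans
    ((measure_selectors_mem_le h0.le h1 hθ hind hp {t | ∃ x ∈ sparseBall N s, δ / 2 <
      |sampleDeviation (((Real.sqrt N : ℝ) : ℂ) • U) m x t|}).trans
      (ENNReal.ofReal_le_ofReal ?_))
  · exact exists_lt_abs_sampleDeviation hm0 hδ _ hω
  · refine cubeProb_sup_le_of_sample_size hK hs (fun i j => ?_) (fun x => ?_) hm2 hmN h0 h1
      (by field_simp) hδ hδ1 hη hη1 ?_ ?_
    · rw [Matrix.smul_apply, smul_eq_mul, norm_mul, Complex.norm_real,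
        Real.norm_of_nonneg (Real.sqrt_nonneg _)]
      exact hUK i j
    · simp only [norm_sqrt_smul_mulVec_sq, ← Finset.mul_sum,
        sum_norm_sq_mulVec_of_mem_unitaryGroup hU]
    · exact hsize ((le_of_eq (by ring)).trans (le_max_left _ _))
    · exact hsize (le_max_right _ _)
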